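/- Let $n\ge 1$ and $p\ge 0$ be integers, let $n_1,\dots,n_p$ be integers with $0<n_k<n$, and put $n'_k=n-n_k$. For $x=(x_1,\dots,x_p)\in\mathbb C^p$ and $t\in[0,1]$ put $y_k=x_k\,t^{n_k/n}(1-t)^{n'_k/n}$ and $$f_\pm(x,t)=1+\sum_{k=1}^p y_k\,e^{\pm n'_k\pi i/n},\qquad \Sigma_\pm=\{x\in\mathbb C^p:\ f_\pm(x,t)=0\text{ for some }t\in[0,1]\}.$$ Let $U$ be the connected component of $\mathbb C^p\setminus(\Sigma_-\cup\Sigma_+)$ that contains $0$. Then there is exactly one holomorphic function $z:U\to\mathbb C$ (the principal root) with $z(0)=1$ and $$z(x)^n+\sum_{k=1}^p x_k\,z(x)^{n_k}-1=0\qquad(x\in U).$$ Moreover, for every $x\in U$ there are continuous branches of $t\mapsto\log f_\pm(x,t)$ on $[0,1]$ that vanish at $t=0$ (where $f_\pm=1$), and with these branches, for every real $\mu$ with $0<\mu<\min_k n'_k$ (in particular for every $0<\mu<1$), the following integral converges absolutely and $$z(x)^\mu=1+\frac{\mu}{(2\pi i)\,n}\int_0^1 t^{\frac{\mu}{n}-1}(1-t)^{-\frac{\mu}{n}-1}\Big[e^{\frac{\mu}{n}\pi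 i}\log f_-(x,t)-e^{-\frac{\mu}{n}\pi i}\log f_+(x,t)\Big]\,dt,$$ where $z(x)^\mu$ is the principal power. (If $p=0$, the condition on $\mu$ is just $\mu>0$. If $f_\pm(x,\cdot)$ avoids $(-\infty,0]$, the branch is the principal logarithm.) -/

import Mathlib

/-- The loop `t ↦ 1 + ∑ₖ yₖ(t) e^{σ n'ₖ π i / n}`, where `n'ₖ = n - nₖ` and
`yₖ(t) = xₖ t^{nₖ/n} (1-t)^{n'ₖ/n}`. Only `σ = 1` and `σ = -1` are used. -/
noncomputable def logArg {p : ℕ} (n : ℕ) (m : Fin p → ℕ) (σ : ℝ) (x : Fin p → ℂ) (t : ℝ) : ℂ :=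
  1 + ∑ k, x k * ((t ^ ((m k : ℝ) / n) * (1 - t) ^ (((n : ℝ) - m k) / n) : ℝ) : ℂ)
    * Complex.exp (σ * ((((n : ℝ) - m k) / n : ℝ) : ℂ) * Real.pi * Complex.I)

/-- The set of coefficient vectors `x` for which `1 + ∑ₖ yₖ(t) e^{σ n'ₖ π i / n}` vanishes at
some `t ∈ [0,1]`: this is `Σ₋` for `σ = -1` and `Σ₊` for `σ = 1`. -/
def singularSet {p : ℕ} (n : ℕ) (m : Fin p → ℕ) (σ : ℝ) : Set (Fin p → ℂ) :=
  {x | ∃ t ∈ Set.Icc (0 : ℝ) 1, logArg n m σ x t = 0}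

/-- The connected component of the origin in `ℂᵖ \ (Σ₋ ∪ Σ₊)`. -/
def principalDomain {p : ℕ} (n : ℕ) (m : Fin p → ℕ) : Set (Fin p → ℂ) :=
  connectedComponentIn (singularSet n m (-1) ∪ singularSet n m 1)ᶜ 0

/-- `z` is, on `principalDomain n m`, a holomorphic branch of the solution of
`z^n + ∑ₖ xₖ z^{nₖ} - 1 = 0` with `z(0) = 1`. -/
structure IsPrincipalRoot {p : ℕ} (n : ℕ) (m : Fin p → ℕ) (z : (Fin p → ℂ) → ℂ) : Prop where
  holomorphic : DifferentiableOn ℂ z (principalDomain n m)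
  at_zero : z 0 = 1
  root : ∀ x ∈ principalDomain n m, z x ^ n + ∑ k, x k * z x ^ m k - 1 = 0

/-- `L` is the continuous branch of `log f` along `[0,1]` that starts from the value `0`. -/
structure IsLogBranch (f L : ℝ → ℂ) : Prop where
  cont : ContinuousOn L (Set.Icc 0 1)
  start : L 0 = 0
  exp_eq : ∀ t ∈ Set.Icc (0 : ℝ) 1, Complex.exp (L t) = f t

/-- If `f` avoids the negative real axis, the branch is the principal logarithm. -/
theorem isLogBranch_log {f : ℝ → ℂ} (hf : ContinuousOn f (Set.Icc 0 1)) (h0 : f 0 = 1)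
    (hs : ∀ t ∈ Set.Icc (0 : ℝ) 1, f t ∈ Complex.slitPlane) :
    IsLogBranch f (fun t => Complex.log (f t)) where
  cont := hf.clog hs
  start := by simp [h0]
  exp_eq t ht := Complex.exp_log (Complex.slitPlane_ne_zero (hs t ht))

/-- The integrand `t^{μ/n-1} (1-t)^{-μ/n-1} [e^{μπi/n} L₋(t) - e^{-μπi/n} L₊(t)]`. -/
noncomputable def rootIntegrand (n : ℕ) (μ : ℝ) (Lm Lp : ℝ → ℂ) (t : ℝ) : ℂ :=
  ((t ^ (μ / n - 1) * (1 - t) ^ (-(μ / n) - 1) : ℝ) : ℂ) *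
    (Complex.exp (((μ / n : ℝ) : ℂ) * Real.pi * Complex.I) * Lm t
      - Complex.exp (-(((μ / n : ℝ) : ℂ) * Real.pi * Complex.I)) * Lp t)

/-! Put t = e^{nu}/(1+e^{nu}), P_x(w) = 1 - e^{nw} - ∑ x_k e^{n_k w} and A_v(w) = ∑ v_k e^{n_k w}.
Then f_±(x,t) = (1-t) P_x(u ∓ πi/n) (`logArg_sigmoid`): up to a positive factor the two loops are
P_x on the boundary of the strip |Im w| ≤ π/n, and x lies in Σ_- ∪ Σ_+ exactly when P_x vanishes on
that boundary.

After this substitution the derivative of the right-hand side in direction v is 1/(2πi) times the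
integral of μ e^{μw} A_v/P_x around the strip. If P_x has a single zero w₀ there, and it is simple,
the residue theorem gives μ e^{μw₀} A_v(w₀)/P_x'(w₀), which is the derivative of e^{μ w₀(x)} by
implicit differentiation (`fderiv_rootPower_eq`). The zero is counted only near the origin, on
complex lines ℂx with ∑ x_k ≠ 0 parametrised by the zero w itself; there the right-hand side is
e^{μw} (`eventually_rootPower_eq`).

The rest is analytic continuation. The right-hand side is holomorphic on U
(`hasFDerivAt_logIntegral`), so its square for μ = 1/2 defines z on all of U, and identities spread
from the origin by `eqOn_zero_of_eventually_zeroScale`. The principal power is holomorphic because z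
cannot leave the sector |arg z| < π/n without x meeting Σ_± (`IsPrincipalRoot.abs_arg_lt`).

Convergence rests on a bound of the logarithms by the weights, which makes them vanish at t = 1 too;
an open-closed argument carries it over U (`exists_isBoundedLog`). -/

open Complex MeasureTheory Filter Topology

/-! ### Cauchy's formula on rectangles and strips -/

/-- The integral of `1 / (ζ - w₀)` over the boundary of a rectangle around `w₀`. -/
theorem integral_boundary_rect_inv_sub {z w w₀ : ℂ} (h₁ : z.re < w₀.re) (h₂ : w₀.re < w.re)
    (h₃ : z.im < w₀.im) (h₄ : w₀.im < w.im) :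
    (∫ x : ℝ in z.re..w.re, ((x + z.im * I : ℂ) - w₀)⁻¹) -
      (∫ x : ℝ in z.re..w.re, ((x + w.im * I : ℂ) - w₀)⁻¹) +
      I * (∫ y : ℝ in z.im..w.im, ((w.re + y * I : ℂ) - w₀)⁻¹) -
      I * (∫ y : ℝ in z.im..w.im, ((z.re + y * I : ℂ) - w₀)⁻¹) = 2 * Real.pi * I := by
  have hor (c : ℝ) (hc : c ≠ w₀.im) (a b : ℝ) :
      ∫ x : ℝ in a..b, ((x + c * I : ℂ) - w₀)⁻¹
        = log ((b + c * I : ℂ) - w₀) - log ((a + c * I : ℂ) - w₀) := by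
    have hne (x : ℝ) : ((x + c * I : ℂ) - w₀).im ≠ 0 := by simpa [sub_eq_zero] using hc
    apply intervalIntegral.integral_eq_sub_of_hasDerivAt
      (f := fun x : ℝ => log ((x + c * I : ℂ) - w₀))
    · intro x _
      have h := ((ofRealCLM.hasDerivAt (x := x)).add_const (c * I : ℂ)).sub_const w₀
      simpa using h.clog_real (Or.inr (hne x))
    · refine Continuous.intervalIntegrable (Continuous.inv₀ (by fun_prop) fun x h => hne x ?_) _ _
      rw [h]; simp
  -- The factor ε = -1 turns the left side away from the cut of `log`; undoing it at the two left
  -- corners costs ±πi, and these add up to 2πi.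
  have ver (c : ℝ) (ε : ℂ) (hε : ε ≠ 0)
      (hc : ∀ y : ℝ, ε * ((c + y * I : ℂ) - w₀) ∈ slitPlane) (a b : ℝ) :
      I * ∫ y : ℝ in a..b, ((c + y * I : ℂ) - w₀)⁻¹
        = log (ε * ((c + b * I : ℂ) - w₀)) - log (ε * ((c + a * I : ℂ) - w₀)) := by
    have hne (y : ℝ) : (c + y * I : ℂ) - w₀ ≠ 0 := fun h => slitPlane_ne_zero (hc y) (by simp [h])
    rw [← intervalIntegral.integral_const_mul]
    apply intervalIntegral.integral_eq_sub_of_hasDerivAt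
      (f := fun y : ℝ => log (ε * ((c + y * I : ℂ) - w₀)))
    · intro y _
      have h := ((((ofRealCLM.hasDerivAt (x := y)).mul_const I).const_add (c : ℂ)).sub_const
        w₀).const_mul ε
      have h' := h.clog_real (hc y)
      have e : I * ((c + y * I : ℂ) - w₀)⁻¹
          = ε * (ofRealCLM 1 * I) / (ε * ((c : ℂ) + ofRealCLM y * I - w₀)) := by
        have := hne y
        simp only [ofRealCLM_apply, ofReal_one, one_mul]
        field_simp
      rw [e]
      exact h'
    · exact (continuous_const.mul (Continuous.inv₀ (by fun_prop) hne)).intervalIntegrable _ _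
  have h₅ := ver w.re 1 one_ne_zero (fun y => Or.inl (by simpa using h₂)) z.im w.im
  have h₆ := ver z.re (-1) (by simp) (fun y => Or.inl (by simpa using h₁)) z.im w.im
  rw [hor _ h₃.ne, hor _ h₄.ne', h₅, h₆]
  simp only [one_mul, neg_one_mul]
  have h₇ : log (-((z.re + w.im * I : ℂ) - w₀))
      = log ((z.re + w.im * I : ℂ) - w₀) - Real.pi * I := by
    simp only [log, norm_neg]
    rw [arg_neg_eq_arg_sub_pi_of_im_pos (by simpa using h₄)]
    push_cast; ring
  have h₈ : log (-((z.re + z.im * I : ℂ) - w₀))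
      = log ((z.re + z.im * I : ℂ) - w₀) + Real.pi * I := by
    simp only [log, norm_neg]
    rw [arg_neg_eq_arg_add_pi_of_im_neg (by simpa using h₃)]
    push_cast; ring
  rw [h₇, h₈]; ring

/-- Cauchy's integral formula for a rectangle. -/
theorem integral_boundary_rect_div_sub {M : ℂ → ℂ} {z w w₀ : ℂ} {s : Set ℂ} (hs : IsOpen s)
    (hM : DifferentiableOn ℂ M s) (hsub : Set.uIcc z.re w.re ×ℂ Set.uIcc z.im w.im ⊆ s)
    (h₁ : z.re < w₀.re) (h₂ : w₀.re < w.re) (h₃ : z.im < w₀.im) (h₄ : w₀.im < w.im) :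
    (∫ x : ℝ in z.re..w.re, M (x + z.im * I) / ((x + z.im * I : ℂ) - w₀)) -
      (∫ x : ℝ in z.re..w.re, M (x + w.im * I) / ((x + w.im * I : ℂ) - w₀)) +
      I * (∫ y : ℝ in z.im..w.im, M (w.re + y * I) / ((w.re + y * I : ℂ) - w₀)) -
      I * (∫ y : ℝ in z.im..w.im, M (z.re + y * I) / ((z.re + y * I : ℂ) - w₀))
      = 2 * Real.pi * I * M w₀ := by
  have hR : w₀ ∈ s := hsub ⟨Set.mem_uIcc.2 (Or.inl ⟨h₁.le, h₂.le⟩),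
    Set.mem_uIcc.2 (Or.inl ⟨h₃.le, h₄.le⟩)⟩
  -- M(ζ)/(ζ - w₀) is `dslope M w₀`, whose boundary integral vanishes by Cauchy, plus M(w₀)/(ζ -
  -- w₀).
  have hd : DifferentiableOn ℂ (dslope M w₀) s :=
    (differentiableOn_dslope (hs.mem_nhds hR)).2 hM
  have h0 := integral_boundary_rect_eq_zero_of_differentiableOn (dslope M w₀) z w (hd.mono hsub)
  have key (γ : ℝ → ℂ) (a b : ℝ) (hγ : Continuous γ) (hne : ∀ x, γ x ≠ w₀)
      (hγs : ∀ x ∈ Set.uIcc a b, γ x ∈ s) :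
      ∫ x in a..b, M (γ x) / (γ x - w₀)
        = (∫ x in a..b, dslope M w₀ (γ x)) + M w₀ * ∫ x in a..b, (γ x - w₀)⁻¹ := by
    rw [← intervalIntegral.integral_const_mul, ← intervalIntegral.integral_add]
    · refine intervalIntegral.integral_congr fun x _ => ?_
      have : γ x - w₀ ≠ 0 := sub_ne_zero.2 (hne x)
      simp only [dslope_of_ne _ (hne x), slope, vsub_eq_sub, smul_eq_mul]
      field_simp; ring
    · exact (hd.continuousOn.comp hγ.continuousOn fun x hx => hγs x hx).intervalIntegrable
    · exact (continuous_const.mul (Continuous.inv₀ (by fun_prop)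
        fun x => sub_ne_zero.2 (hne x))).intervalIntegrable _ _
  have e1 := integral_boundary_rect_inv_sub h₁ h₂ h₃ h₄
  have zr : z.re ∈ Set.uIcc z.re w.re := Set.left_mem_uIcc
  have wr : w.re ∈ Set.uIcc z.re w.re := Set.right_mem_uIcc
  have zi : z.im ∈ Set.uIcc z.im w.im := Set.left_mem_uIcc
  have wi : w.im ∈ Set.uIcc z.im w.im := Set.right_mem_uIcc
  have mem (x y : ℝ) (hx : x ∈ Set.uIcc z.re w.re) (hy : y ∈ Set.uIcc z.im w.im) :
      (x + y * I : ℂ) ∈ s := hsub ⟨by simpa using hx, by simpa using hy⟩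
  have neI (x y : ℝ) (h : y ≠ w₀.im) : (x + y * I : ℂ) ≠ w₀ := fun h' => h (by rw [← h']; simp)
  have neR (x y : ℝ) (h : x ≠ w₀.re) : (x + y * I : ℂ) ≠ w₀ := fun h' => h (by rw [← h']; simp)
  rw [key (fun x => x + z.im * I) _ _ (by fun_prop) (fun x => neI _ _ h₃.ne)
      (fun x hx => mem _ _ hx zi),
    key (fun x => x + w.im * I) _ _ (by fun_prop) (fun x => neI _ _ h₄.ne')
      (fun x hx => mem _ _ hx wi),
    key (fun y => w.re + y * I) _ _ (by fun_prop) (fun x => neR _ _ h₂.ne')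
      (fun x hx => mem _ _ wr hx),
    key (fun y => z.re + y * I) _ _ (by fun_prop) (fun x => neR _ _ h₁.ne)
      (fun x hx => mem _ _ zr hx)]
  simp only [smul_eq_mul] at h0
  linear_combination h0 + M w₀ * e1

/-- Residue formula for a horizontal strip: `M w / (w - w₀)` decays at both ends. -/
theorem integral_strip_div_sub {M : ℂ → ℂ} {w₀ : ℂ} {a : ℝ} {s : Set ℂ} (hs : IsOpen s)
    (hM : DifferentiableOn ℂ M s) (hsub : {w : ℂ | |w.im| ≤ a} ⊆ s) (hw₀ : |w₀.im| < a)
    {g : ℝ → ℝ} (hg : ∀ᶠ r : ℝ in atTop, ∀ y : ℝ, |y| ≤ a →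
      ‖M (r + y * I) / ((r + y * I : ℂ) - w₀)‖ ≤ g r ∧
      ‖M (-r + y * I) / ((-r + y * I : ℂ) - w₀)‖ ≤ g r)
    (hg0 : Tendsto g atTop (𝓝 0))
    (hbot : Integrable fun u : ℝ => M (u + (-a : ℝ) * I) / ((u + (-a : ℝ) * I : ℂ) - w₀))
    (htop : Integrable fun u : ℝ => M (u + a * I) / ((u + a * I : ℂ) - w₀)) :
    (∫ u : ℝ, M (u + (-a : ℝ) * I) / ((u + (-a : ℝ) * I : ℂ) - w₀)) -
      (∫ u : ℝ, M (u + a * I) / ((u + a * I : ℂ) - w₀)) = 2 * Real.pi * I * M w₀ := by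
  have ha : 0 < a := (abs_nonneg _).trans_lt hw₀
  have t1 := intervalIntegral_tendsto_integral hbot tendsto_neg_atTop_atBot tendsto_id
  have t2 := intervalIntegral_tendsto_integral htop tendsto_neg_atTop_atBot tendsto_id
  have side (ε : ℝ → ℝ) (hε : ∀ᶠ r : ℝ in atTop, ∀ y : ℝ, |y| ≤ a →
      ‖M (ε r + y * I) / ((ε r + y * I : ℂ) - w₀)‖ ≤ g r) :
      Tendsto (fun r : ℝ => I * ∫ y : ℝ in (-a)..a, M (ε r + y * I) / ((ε r + y * I : ℂ) - w₀))
        atTop (𝓝 0) := by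
    have hlim : Tendsto (fun r => g r * |a - -a|) atTop (𝓝 0) := by simpa using hg0.mul_const _
    refine squeeze_zero_norm' ?_ hlim
    filter_upwards [hε] with r hr
    rw [norm_mul, norm_I, one_mul]
    refine intervalIntegral.norm_integral_le_of_norm_le_const fun y hy => hr y ?_
    rw [Set.uIoc_of_le (by linarith)] at hy
    exact abs_le.2 ⟨hy.1.le, hy.2⟩
  have t3 := side id (hg.mono fun r h y hy => (h y hy).1)
  have t4 := side (fun r => -r) (hg.mono fun r h y hy => by simpa using (h y hy).2)
  have t5 := ((t1.sub t2).add t3).sub t4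
  rw [add_zero, sub_zero] at t5
  refine tendsto_nhds_unique t5 (tendsto_const_nhds.congr' ?_)
  filter_upwards [eventually_gt_atTop |w₀.re|] with r hr
  have hr' := abs_lt.1 hr
  have ha' := abs_lt.1 hw₀
  have := integral_boundary_rect_div_sub (z := ⟨-r, -a⟩) (w := ⟨r, a⟩) hs hM ?_ hr'.1 hr'.2 ha'.1
    ha'.2
  · exact this.symm
  · rintro w ⟨-, hw⟩
    refine hsub ?_
    have hw : w.im ∈ Set.uIcc (-a) a := hw
    rw [Set.uIcc_of_le (by linarith)] at hw
    exact abs_le.2 hw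

/-! ### Identity theorem in several variables -/

/-- Identity theorem on a connected open subset of a complex normed space. -/
theorem DifferentiableOn.eqOn_zero_of_preconnected {E : Type*} [NormedAddCommGroup E]
    [NormedSpace ℂ E] {f : E → ℂ} {U : Set E} (hU : IsOpen U) (hc : IsPreconnected U)
    (hf : DifferentiableOn ℂ f U) {x₀ : E} (hx₀ : x₀ ∈ U) (h : ∀ᶠ x in 𝓝 x₀, f x = 0) :
    Set.EqOn f 0 U := by
  -- The set where f vanishes locally is relatively closed: in a ball around a limit point, each y
  -- shares a complex line with a point b near which f vanishes, and the one-variable theorem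
  -- applies on that line.
  have hsub : U ⊆ {x | ∀ᶠ y in 𝓝 x, f y = 0} := by
    refine hc.subset_of_closure_inter_subset isOpen_setOfPred_eventually_nhds ⟨x₀, hx₀, h⟩ ?_
    rintro x ⟨hx, hxU⟩
    obtain ⟨r, hr, hball⟩ := Metric.isOpen_iff.1 hU x hxU
    obtain ⟨b, hb, hbx⟩ := Metric.mem_closure_iff.1 hx r hr
    have hbx : b ∈ Metric.ball x r := by rwa [Metric.mem_ball, dist_comm]
    filter_upwards [Metric.ball_mem_nhds x hr] with y hy
    let ℓ : ℂ → E := fun s => b + s • (y - b)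
    have hℓ : Differentiable ℂ ℓ := by fun_prop
    let V : Set ℂ := ℓ ⁻¹' Metric.ball x r
    have hVo : IsOpen V := Metric.isOpen_ball.preimage hℓ.continuous
    have hVc : Convex ℝ V := by
      intro s hs t ht α β hα hβ hab
      have := convex_ball x r hs ht hα hβ hab
      have e : ℓ (α • s + β • t) = α • ℓ s + β • ℓ t := by
        obtain rfl : β = 1 - α := by linarith
        simp only [ℓ, ← Complex.coe_smul]
        push_cast
        module
      exact Set.mem_preimage.2 (e ▸ this)
    have hd : DifferentiableOn ℂ (f ∘ ℓ) V :=
      (hf.mono hball).comp hℓ.differentiableOn fun s hs => hs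
    have h0V : (0 : ℂ) ∈ V := by simpa [V, ℓ] using hbx
    have h1V : (1 : ℂ) ∈ V := by simpa [V, ℓ] using hy
    have hev : ∀ᶠ s in 𝓝 (0 : ℂ), (f ∘ ℓ) s = 0 := by
      have : Tendsto ℓ (𝓝 0) (𝓝 b) := by simpa [ℓ] using hℓ.continuous.tendsto 0
      exact this.eventually hb
    have := (hd.analyticOnNhd hVo).eqOn_zero_of_preconnected_of_eventuallyEq_zero
      hVc.isPreconnected h0V hev h1V
    simpa [ℓ] using this
  exact fun x hx => (hsub hx).self_of_nhds

/-! ### The loops and their logarithms -/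

/-- The sum of the weights `t^{nₖ/n} (1-t)^{n'ₖ/n}`. -/
noncomputable def weightSum {p : ℕ} (n : ℕ) (m : Fin p → ℕ) (t : ℝ) : ℝ :=
  ∑ k, t ^ ((m k : ℝ) / n) * (1 - t) ^ (((n : ℝ) - m k) / n)

/-- The linear part of `x ↦ logArg n m σ x t`. -/
noncomputable def logArgLin {p : ℕ} (n : ℕ) (m : Fin p → ℕ) (σ : ℝ) (t : ℝ) :
    (Fin p → ℂ) →L[ℂ] ℂ :=
  ∑ k, (((t ^ ((m k : ℝ) / n) * (1 - t) ^ (((n : ℝ) - m k) / n) : ℝ) : ℂ)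
    * exp (σ * ((((n : ℝ) - m k) / n : ℝ) : ℂ) * Real.pi * I)) •
      ContinuousLinearMap.proj (R := ℂ) (φ := fun _ : Fin p => ℂ) k

section
variable {p n : ℕ} {m : Fin p → ℕ}

theorem logArg_eq (σ : ℝ) (x : Fin p → ℂ) (t : ℝ) :
    logArg n m σ x t = 1 + logArgLin n m σ t x := by
  simp only [logArg, logArgLin, sum_apply, smul_apply,
    ContinuousLinearMap.proj_apply, smul_eq_mul]
  congr 1
  exact Finset.sum_congr rfl fun k _ => by ring

theorem logArg_zero_left (σ t : ℝ) : logArg n m σ 0 t = 1 := by simp [logArg]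

theorem exponent_pos (hm : ∀ k, 0 < m k ∧ m k < n) (k : Fin p) :
    0 < (m k : ℝ) / n ∧ 0 < ((n : ℝ) - m k) / n := by
  have h1 : (0 : ℝ) < m k := by exact_mod_cast (hm k).1
  have h2 : (m k : ℝ) < n := by exact_mod_cast (hm k).2
  exact ⟨div_pos h1 (by linarith), div_pos (by linarith) (by linarith)⟩

theorem continuous_weight (hm : ∀ k, 0 < m k ∧ m k < n) (k : Fin p) :
    Continuous fun t : ℝ => t ^ ((m k : ℝ) / n) * (1 - t) ^ (((n : ℝ) - m k) / n) := by
  have h := exponent_pos hm k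
  exact (continuous_id.rpow_const fun _ => Or.inr h.1.le).mul
    ((continuous_const.sub continuous_id).rpow_const fun _ => Or.inr h.2.le)

theorem continuous_logArgLin (hm : ∀ k, 0 < m k ∧ m k < n) (σ : ℝ) :
    Continuous (logArgLin n m σ) := by
  unfold logArgLin
  refine continuous_finsetSum _ fun k _ => Continuous.fun_smul ?_ continuous_const
  exact (continuous_ofReal.comp (continuous_weight hm k)).mul continuous_const

theorem continuous_logArg (hm : ∀ k, 0 < m k ∧ m k < n) (σ : ℝ) (x : Fin p → ℂ) :
    Continuous (logArg n m σ x) := by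
  have : logArg n m σ x = fun t => 1 + logArgLin n m σ t x := funext fun t => logArg_eq σ x t
  rw [this]
  exact continuous_const.add ((continuous_logArgLin hm σ).clm_apply continuous_const)

theorem weight_nonneg {t : ℝ} (ht : t ∈ Set.Icc (0 : ℝ) 1) (a b : ℝ) :
    0 ≤ t ^ a * (1 - t) ^ b :=
  mul_nonneg (Real.rpow_nonneg ht.1 _) (Real.rpow_nonneg (by linarith [ht.2]) _)

theorem weightSum_nonneg {t : ℝ} (ht : t ∈ Set.Icc (0 : ℝ) 1) : 0 ≤ weightSum n m t :=
  Finset.sum_nonneg fun _ _ => weight_nonneg ht _ _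

theorem weightSum_le (hm : ∀ k, 0 < m k ∧ m k < n) {t : ℝ} (ht : t ∈ Set.Icc (0 : ℝ) 1) :
    weightSum n m t ≤ p := by
  refine (Finset.sum_le_card_nsmul _ _ 1 fun k _ => ?_).trans (by simp)
  have h := exponent_pos hm k
  exact mul_le_one₀ (Real.rpow_le_one ht.1 ht.2 h.1.le)
    (Real.rpow_nonneg (by linarith [ht.2]) _)
    (Real.rpow_le_one (by linarith [ht.2]) (by linarith [ht.1]) h.2.le)

theorem norm_logArgLin_le (σ : ℝ) {t : ℝ} (ht : t ∈ Set.Icc (0 : ℝ) 1) :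
    ‖logArgLin n m σ t‖ ≤ weightSum n m t := by
  refine (norm_sum_le _ _).trans (Finset.sum_le_sum fun k _ => ?_)
  rw [norm_smul, norm_mul, norm_real, Real.norm_of_nonneg (weight_nonneg ht _ _)]
  have h1 : ‖exp (σ * ((((n : ℝ) - m k) / n : ℝ) : ℂ) * Real.pi * I)‖ = 1 := by
    have := norm_exp_ofReal_mul_I (σ * (((n : ℝ) - m k) / n) * Real.pi)
    push_cast at this ⊢
    exact this
  rw [h1, mul_one]
  refine mul_le_of_le_one_right (weight_nonneg ht _ _) ?_
  exact ContinuousLinearMap.opNorm_le_bound _ zero_le_one fun x => by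
    simpa using norm_le_pi_norm x k

theorem norm_logArg_sub_le (σ : ℝ) (x y : Fin p → ℂ) {t : ℝ} (ht : t ∈ Set.Icc (0 : ℝ) 1) :
    ‖logArg n m σ x t - logArg n m σ y t‖ ≤ weightSum n m t * ‖x - y‖ := by
  rw [logArg_eq, logArg_eq, add_sub_add_left_eq_sub, ← map_sub]
  exact ((logArgLin n m σ t).le_opNorm _).trans
    (mul_le_mul_of_nonneg_right (norm_logArgLin_le σ ht) (norm_nonneg _))

theorem logArg_at_zero (hm : ∀ k, 0 < m k ∧ m k < n) (σ : ℝ) (x : Fin p → ℂ) :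
    logArg n m σ x 0 = 1 := by
  simp [logArg, fun k => Real.zero_rpow (exponent_pos hm k).1.ne']

theorem exists_pos_le_norm_logArg (hm : ∀ k, 0 < m k ∧ m k < n) {σ : ℝ} {x : Fin p → ℂ}
    (hx : x ∉ singularSet n m σ) :
    ∃ ε > 0, ∀ t ∈ Set.Icc (0 : ℝ) 1, ε ≤ ‖logArg n m σ x t‖ := by
  obtain ⟨t₀, ht₀, hmin⟩ := isCompact_Icc.exists_isMinOn (Set.nonempty_Icc.2 zero_le_one)
    (continuous_logArg hm σ x).norm.continuousOn
  exact ⟨_, norm_pos_iff.2 fun h => hx ⟨t₀, ht₀, h⟩, fun t ht => hmin ht⟩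

/-- Off the singular set, `logArg` and its logarithmic increments are controlled locally
uniformly. -/
theorem exists_ball_logArg (hm : ∀ k, 0 < m k ∧ m k < n) {σ : ℝ} {x₀ : Fin p → ℂ}
    (hx₀ : x₀ ∉ singularSet n m σ) :
    ∃ δ > 0, ∃ ε > 0, ∀ x ∈ Metric.ball x₀ δ, ∀ t ∈ Set.Icc (0 : ℝ) 1,
      ε ≤ ‖logArg n m σ x t‖ ∧
      ‖logArg n m σ x t / logArg n m σ x₀ t - 1‖ ≤ 1 / 2 ∧
      ‖log (logArg n m σ x t / logArg n m σ x₀ t)‖ ≤ weightSum n m t := by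
  obtain ⟨ε, hε, hle⟩ := exists_pos_le_norm_logArg hm hx₀
  -- As `weightSum` is at most p, this radius moves the loop by at most ε/2; p + 1 keeps the
  -- denominator positive when p = 0.
  refine ⟨ε / (2 * (p + 1)), by positivity, ε / 2, by positivity, fun x hx t ht => ?_⟩
  have hd : ‖x - x₀‖ ≤ ε / (2 * (p + 1)) := by
    rw [← dist_eq_norm]; exact (Metric.mem_ball.1 hx).le
  have h1 := norm_logArg_sub_le (n := n) (m := m) σ x x₀ ht
  have hw := weightSum_le hm ht
  have hw0 := weightSum_nonneg (n := n) (m := m) ht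
  have hp : (0 : ℝ) ≤ p := p.cast_nonneg
  have h2 : weightSum n m t * ‖x - x₀‖ ≤ weightSum n m t * (ε / 2) := by
    refine mul_le_mul_of_nonneg_left (hd.trans ?_) hw0
    gcongr; linarith
  have h3 : weightSum n m t * ‖x - x₀‖ ≤ ε / 2 := by
    calc weightSum n m t * ‖x - x₀‖ ≤ (p + 1) * (ε / (2 * (p + 1))) := by
          gcongr; linarith
      _ = ε / 2 := by field_simp
  have h0 := hle t ht
  have hne : logArg n m σ x₀ t ≠ 0 := norm_pos_iff.1 (hε.trans_le h0)
  have e : logArg n m σ x t / logArg n m σ x₀ t - 1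
      = (logArg n m σ x t - logArg n m σ x₀ t) / logArg n m σ x₀ t := by field_simp
  have h4 : ‖logArg n m σ x t / logArg n m σ x₀ t - 1‖ ≤ weightSum n m t * ‖x - x₀‖ / ε := by
    rw [e, norm_div]
    gcongr
  have h5 : ‖logArg n m σ x t / logArg n m σ x₀ t - 1‖ ≤ 1 / 2 :=
    h4.trans ((div_le_iff₀ hε).2 (by linarith))
  refine ⟨?_, h5, ?_⟩
  · have := norm_sub_norm_le (logArg n m σ x₀ t) (logArg n m σ x t)
    rw [norm_sub_rev] at this
    linarith
  · have h6 := norm_log_one_add_half_le_self h5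
    rw [add_sub_cancel] at h6
    have h7 : weightSum n m t * ‖x - x₀‖ / ε ≤ weightSum n m t / 2 :=
      (div_le_iff₀ hε).2 (by linarith)
    linarith

theorem isOpen_compl_singularSet (hm : ∀ k, 0 < m k ∧ m k < n) (σ : ℝ) :
    IsOpen (singularSet n m σ)ᶜ := by
  refine Metric.isOpen_iff.2 fun x hx => ?_
  obtain ⟨δ, hδ, ε, hε, h⟩ := exists_ball_logArg hm hx
  refine ⟨δ, hδ, fun y hy ⟨t, ht, h0⟩ => ?_⟩
  have := (h y hy t ht).1
  rw [h0, norm_zero] at this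
  linarith

theorem isOpen_principalDomain (hm : ∀ k, 0 < m k ∧ m k < n) : IsOpen (principalDomain n m) := by
  refine IsOpen.connectedComponentIn ?_
  rw [Set.compl_union]
  exact (isOpen_compl_singularSet hm _).inter (isOpen_compl_singularSet hm _)

theorem zero_mem_principalDomain : (0 : Fin p → ℂ) ∈ principalDomain n m := by
  refine mem_connectedComponentIn ?_
  rintro (⟨t, -, h⟩ | ⟨t, -, h⟩) <;> simp [logArg_zero_left] at h

theorem isPreconnected_principalDomain : IsPreconnected (principalDomain n m) :=
  isPreconnected_connectedComponentIn

theorem notMem_singularSet {x : Fin p → ℂ} (hx : x ∈ principalDomain n m) {σ : ℝ}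
    (hσ : σ = -1 ∨ σ = 1) : x ∉ singularSet n m σ := by
  have := connectedComponentIn_subset _ _ hx
  rw [Set.compl_union] at this
  rcases hσ with rfl | rfl
  exacts [this.1, this.2]

theorem mem_slitPlane_of_norm_sub_one_le {z : ℂ} (h : ‖z - 1‖ ≤ 1 / 2) : z ∈ slitPlane := by
  have := mem_slitPlane_of_norm_lt_one (z := z - 1) (by linarith)
  rwa [add_sub_cancel] at this

/-- A logarithm of `logArg n m σ x` along `[0,1]`, bounded by the weights. -/
def IsBoundedLog (n : ℕ) (m : Fin p → ℕ) (σ : ℝ) (x : Fin p → ℂ) (L : ℝ → ℂ) : Prop :=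
  IsLogBranch (logArg n m σ x) L ∧ ∃ C : ℝ, ∀ t ∈ Set.Icc (0 : ℝ) 1, ‖L t‖ ≤ C * weightSum n m t

theorem continuousOn_log_logArg_div (hm : ∀ k, 0 < m k ∧ m k < n) {σ : ℝ} {x x₀ : Fin p → ℂ}
    (hx₀ : x₀ ∉ singularSet n m σ)
    (h : ∀ t ∈ Set.Icc (0 : ℝ) 1, ‖logArg n m σ x t / logArg n m σ x₀ t - 1‖ ≤ 1 / 2) :
    ContinuousOn (fun t => log (logArg n m σ x t / logArg n m σ x₀ t)) (Set.Icc 0 1) :=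
  ContinuousOn.clog ((continuous_logArg hm σ x).continuousOn.div
    (continuous_logArg hm σ x₀).continuousOn fun t ht h0 => hx₀ ⟨t, ht, h0⟩)
    fun t ht => mem_slitPlane_of_norm_sub_one_le (h t ht)

/-- The quotient of neighbouring loops stays near 1, so its principal logarithm transports a bounded
branch. The passage from x₀ to x gives openness, the one back gives closedness. -/
theorem exists_ball_isBoundedLog (hm : ∀ k, 0 < m k ∧ m k < n) {σ : ℝ} {x₀ : Fin p → ℂ}
    (hx₀ : x₀ ∉ singularSet n m σ) :
    ∃ δ > 0, ∀ x ∈ Metric.ball x₀ δ, ∀ L : ℝ → ℂ,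
      (IsBoundedLog n m σ x₀ L →
        IsBoundedLog n m σ x fun t => L t + log (logArg n m σ x t / logArg n m σ x₀ t)) ∧
      (IsBoundedLog n m σ x L →
        IsBoundedLog n m σ x₀ fun t => L t - log (logArg n m σ x t / logArg n m σ x₀ t)) := by
  obtain ⟨δ, hδ, ε, hε, h⟩ := exists_ball_logArg hm hx₀
  refine ⟨δ, hδ, fun x hx L => ?_⟩
  have hc := continuousOn_log_logArg_div hm hx₀ fun t ht => (h x hx t ht).2.1
  have hne₀ : ∀ t ∈ Set.Icc (0 : ℝ) 1, logArg n m σ x₀ t ≠ 0 := fun t ht h0 => hx₀ ⟨t, ht, h0⟩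
  have hne : ∀ t ∈ Set.Icc (0 : ℝ) 1, logArg n m σ x t ≠ 0 := fun t ht =>
    norm_pos_iff.1 (hε.trans_le (h x hx t ht).1)
  constructor
  · rintro ⟨hL, C, hC⟩
    refine ⟨⟨hL.cont.add hc, by simp [hL.start, logArg_at_zero hm], fun t ht => ?_⟩, C + 1,
      fun t ht => ?_⟩
    · rw [exp_add, hL.exp_eq t ht, exp_log (div_ne_zero (hne t ht) (hne₀ t ht)),
        mul_div_cancel₀ _ (hne₀ t ht)]
    · rw [add_mul, one_mul]
      exact (norm_add_le _ _).trans (add_le_add (hC t ht) (h x hx t ht).2.2)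
  · rintro ⟨hL, C, hC⟩
    refine ⟨⟨hL.cont.sub hc, by simp [hL.start, logArg_at_zero hm], fun t ht => ?_⟩, C + 1,
      fun t ht => ?_⟩
    · rw [exp_sub, hL.exp_eq t ht, exp_log (div_ne_zero (hne t ht) (hne₀ t ht)),
        div_div_cancel₀ (hne t ht)]
    · rw [add_mul, one_mul]
      exact (norm_sub_le _ _).trans (add_le_add (hC t ht) (h x hx t ht).2.2)

theorem exists_isBoundedLog (hm : ∀ k, 0 < m k ∧ m k < n) {σ : ℝ} (hσ : σ = -1 ∨ σ = 1)
    {x : Fin p → ℂ} (hx : x ∈ principalDomain n m) : ∃ L, IsBoundedLog n m σ x L := by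
  suffices principalDomain n m ⊆ {x | ∀ᶠ y in 𝓝 x, ∃ L, IsBoundedLog n m σ y L} from
    (this hx).self_of_nhds
  have key {x₀ : Fin p → ℂ} (hx₀ : x₀ ∈ principalDomain n m) (h : ∃ L, IsBoundedLog n m σ x₀ L) :
      ∀ᶠ y in 𝓝 x₀, ∃ L, IsBoundedLog n m σ y L := by
    obtain ⟨δ, hδ, hb⟩ := exists_ball_isBoundedLog hm (notMem_singularSet hx₀ hσ)
    obtain ⟨L, hL⟩ := h
    filter_upwards [Metric.ball_mem_nhds x₀ hδ] with y hy
    exact ⟨_, (hb y hy L).1 hL⟩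
  refine isPreconnected_principalDomain.subset_of_closure_inter_subset
    isOpen_setOfPred_eventually_nhds ⟨0, zero_mem_principalDomain, key zero_mem_principalDomain
      ⟨0, ⟨continuousOn_const, rfl, fun t _ => by simp [logArg_zero_left]⟩, 0, by simp⟩⟩ ?_
  rintro x₀ ⟨hcl, hx₀⟩
  obtain ⟨δ, hδ, hb⟩ := exists_ball_isBoundedLog hm (notMem_singularSet hx₀ hσ)
  obtain ⟨y, hy, hyd⟩ := Metric.mem_closure_iff.1 hcl δ hδ
  obtain ⟨L, hL⟩ := hy.self_of_nhds
  exact key hx₀ ⟨_, (hb y (by rwa [Metric.mem_ball, dist_comm]) L).2 hL⟩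

end

/-- The continuous branch of the logarithm that starts at `0` is unique. -/
theorem IsLogBranch.eqOn {f L L' : ℝ → ℂ} (h : IsLogBranch f L) (h' : IsLogBranch f L') :
    Set.EqOn L L' (Set.Icc 0 1) := by
  have hd : ContinuousOn (fun t => L t - L' t) (Set.Icc 0 1) := h.cont.sub h'.cont
  have hq : ∀ t ∈ Set.Icc (0 : ℝ) 1, ∃ j : ℤ, L t - L' t = j * (2 * Real.pi * I) := fun t ht =>
    exp_eq_one_iff.1 (by
      rw [exp_sub, h.exp_eq t ht, h'.exp_eq t ht, div_self]
      rw [← h.exp_eq t ht]; exact exp_ne_zero _)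
  have hpi := Real.pi_pos
  -- Two branches differ by 2πi times a continuous integer-valued function, constant on the
  -- connected interval.
  have hcont : ContinuousOn (fun t => ((L t - L' t).im / (2 * Real.pi))) (Set.Icc 0 1) :=
    (continuous_im.comp_continuousOn hd).div_const _
  have hval : ∀ t ∈ Set.Icc (0 : ℝ) 1, (L t - L' t).im / (2 * Real.pi) = 0 := by
    intro t ht
    by_contra hne
    obtain ⟨j, hj⟩ := hq t ht
    have hj' : (L t - L' t).im / (2 * Real.pi) = j := by
      rw [hj]; simp
    have hc := (isPreconnected_Icc (a := (0 : ℝ)) (b := 1)).image _ hcont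
    have hsub : (fun t => ((L t - L' t).im / (2 * Real.pi))) '' Set.Icc 0 1
        ⊆ Set.range ((↑) : ℤ → ℝ) := by
      rintro _ ⟨s, hs, rfl⟩
      obtain ⟨i, hi⟩ := hq s hs
      exact ⟨i, by simp [hi]⟩
    have hsing := (Set.countable_range ((↑) : ℤ → ℝ)).isTotallyDisconnected _ hsub hc
    refine hne ?_
    have := hsing ⟨t, ht, rfl⟩ ⟨0, ⟨le_rfl, zero_le_one⟩, rfl⟩
    simpa [h.start, h'.start] using this
  intro t ht
  obtain ⟨j, hj⟩ := hq t ht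
  have h0 := hval t ht
  rw [hj] at h0
  have : (j : ℝ) = 0 := by simpa [hpi.ne'] using h0
  have : j = 0 := by exact_mod_cast this
  rw [this] at hj
  simpa [sub_eq_zero] using hj

/-! ### Convergence and differentiation of the integrals -/

/-- The kernel `t^{μ/n-1} (1-t)^{-μ/n-1}`. -/
noncomputable def rootKernel (n : ℕ) (μ t : ℝ) : ℝ := t ^ (μ / n - 1) * (1 - t) ^ (-(μ / n) - 1)

theorem intervalIntegrable_rpow_mul_one_sub_rpow {a b : ℝ} (ha : 0 < a) (hb : 0 < b) :
    IntervalIntegrable (fun t : ℝ => t ^ (a - 1) * (1 - t) ^ (b - 1)) volume 0 1 := by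
  have h := (betaIntegral_convergent (u := a) (v := b) (by simpa) (by simpa)).norm
  refine h.congr_uIoo fun t ht => ?_
  rw [Set.uIoo_of_le zero_le_one] at ht
  have h1 : (1 - (t : ℂ)) = ((1 - t : ℝ) : ℂ) := by push_cast; rfl
  simp only [norm_mul]
  rw [h1, norm_cpow_eq_rpow_re_of_pos ht.1, norm_cpow_eq_rpow_re_of_pos (by linarith [ht.2])]
  simp

theorem measurable_rootKernel (n : ℕ) (μ : ℝ) : Measurable (rootKernel n μ) := by
  unfold rootKernel; fun_prop

theorem rootKernel_nonneg {n : ℕ} {μ t : ℝ} (ht : t ∈ Set.Icc (0 : ℝ) 1) : 0 ≤ rootKernel n μ t :=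
  weight_nonneg ht _ _

section
variable {p n : ℕ} {m : Fin p → ℕ} {μ : ℝ}

/-- Each weight turns the kernel into a Beta integrand with parameters (μ + n_k)/n and (n'_k - μ)/n;
the second is positive because μ < n'_k. -/
theorem intervalIntegrable_rootKernel_mul_weightSum (hm : ∀ k, 0 < m k ∧ m k < n) (hμ : 0 < μ)
    (hμn : ∀ k, μ < (n : ℝ) - m k) :
    IntervalIntegrable (fun t => rootKernel n μ t * weightSum n m t) volume 0 1 := by
  have h : IntervalIntegrable (fun t : ℝ => ∑ k, t ^ ((μ + m k) / n - 1)
      * (1 - t) ^ ((n - m k - μ) / n - 1)) volume 0 1 := by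
    rw [intervalIntegrable_iff]
    refine integrable_finsetSum _ fun k _ => ?_
    have h1 : (0 : ℝ) < m k := by exact_mod_cast (hm k).1
    have h2 : (0 : ℝ) < n := by exact_mod_cast (hm k).1.trans (hm k).2
    exact (intervalIntegrable_rpow_mul_one_sub_rpow (by positivity)
      (div_pos (by linarith [hμn k]) h2)).def'
  refine h.congr_uIoo fun t ht => ?_
  rw [Set.uIoo_of_le zero_le_one] at ht
  simp only [rootKernel, weightSum, Finset.mul_sum]
  refine Finset.sum_congr rfl fun k _ => ?_
  have e1 : (μ + m k) / n - 1 = (μ / n - 1) + m k / n := by ring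
  have e2 : ((n : ℝ) - m k - μ) / n - 1 = (-(μ / n) - 1) + (n - m k) / n := by ring
  rw [e1, e2, Real.rpow_add ht.1, Real.rpow_add (by linarith [ht.2])]
  ring

theorem intervalIntegrable_rootKernel_smul {E : Type*} [NormedAddCommGroup E] [NormedSpace ℂ E]
    (hm : ∀ k, 0 < m k ∧ m k < n) (hμ : 0 < μ) (hμn : ∀ k, μ < (n : ℝ) - m k) {g : ℝ → E}
    (hg : ContinuousOn g (Set.Icc 0 1)) {C : ℝ}
    (hC : ∀ t ∈ Set.Icc (0 : ℝ) 1, ‖g t‖ ≤ C * weightSum n m t) :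
    IntervalIntegrable (fun t => (rootKernel n μ t : ℂ) • g t) volume 0 1 := by
  have h := (intervalIntegrable_rootKernel_mul_weightSum hm hμ hμn).const_mul C
  refine h.mono_fun ?_ ?_
  · rw [Set.uIoc_of_le zero_le_one]
    exact ((measurable_ofReal.comp (measurable_rootKernel n μ)).aestronglyMeasurable).smul
      ((hg.aestronglyMeasurable_of_isCompact isCompact_Icc measurableSet_Icc).mono_measure
        (Measure.restrict_mono Set.Ioc_subset_Icc_self le_rfl))
  · rw [Set.uIoc_of_le zero_le_one]
    filter_upwards [ae_restrict_mem measurableSet_Ioc] with t ht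
    have ht' := Set.Ioc_subset_Icc_self ht
    rw [norm_smul, norm_real, Real.norm_of_nonneg (rootKernel_nonneg ht')]
    calc rootKernel n μ t * ‖g t‖ ≤ rootKernel n μ t * (C * weightSum n m t) :=
          mul_le_mul_of_nonneg_left (hC t ht') (rootKernel_nonneg ht')
      _ = C * (rootKernel n μ t * weightSum n m t) := by ring
      _ ≤ _ := Real.le_norm_self _

/-- A choice of bounded branch of `log (logArg n m σ x t)`. -/
noncomputable def branchLog {p : ℕ} (n : ℕ) (m : Fin p → ℕ) (σ : ℝ) (x : Fin p → ℂ) : ℝ → ℂ :=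
  Classical.epsilon (IsBoundedLog n m σ x)

theorem isBoundedLog_branchLog (hm : ∀ k, 0 < m k ∧ m k < n) {σ : ℝ} (hσ : σ = -1 ∨ σ = 1)
    {x : Fin p → ℂ} (hx : x ∈ principalDomain n m) :
    IsBoundedLog n m σ x (branchLog n m σ x) :=
  Classical.epsilon_spec (exists_isBoundedLog hm hσ hx)

/-- `∫₀¹ t^{μ/n-1} (1-t)^{-μ/n-1} log f_σ(x,t) dt`. -/
noncomputable def logIntegral {p : ℕ} (n : ℕ) (m : Fin p → ℕ) (μ σ : ℝ) (x : Fin p → ℂ) : ℂ :=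
  ∫ t in (0 : ℝ)..1, (rootKernel n μ t : ℂ) • branchLog n m σ x t

theorem intervalIntegrable_branchLog (hm : ∀ k, 0 < m k ∧ m k < n) (hμ : 0 < μ)
    (hμn : ∀ k, μ < (n : ℝ) - m k) {σ : ℝ} (hσ : σ = -1 ∨ σ = 1)
    {x : Fin p → ℂ} (hx : x ∈ principalDomain n m) :
    IntervalIntegrable (fun t => (rootKernel n μ t : ℂ) • branchLog n m σ x t) volume 0 1 := by
  obtain ⟨hL, C, hC⟩ := isBoundedLog_branchLog hm hσ hx
  exact intervalIntegrable_rootKernel_smul hm hμ hμn hL.cont hC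

theorem intervalIntegrable_logIntegral_deriv (hm : ∀ k, 0 < m k ∧ m k < n) (hμ : 0 < μ)
    (hμn : ∀ k, μ < (n : ℝ) - m k) {σ : ℝ} {x : Fin p → ℂ} (hx : x ∉ singularSet n m σ) :
    IntervalIntegrable (fun t => (rootKernel n μ t : ℂ) •
      ((logArg n m σ x t)⁻¹ • logArgLin n m σ t)) volume 0 1 := by
  obtain ⟨ε, hε, hle⟩ := exists_pos_le_norm_logArg hm hx
  refine intervalIntegrable_rootKernel_smul hm hμ hμn (C := ε⁻¹) ?_ fun t ht => ?_
  · exact ((continuous_logArg hm σ x).continuousOn.inv₀ fun t ht h0 => hx ⟨t, ht, h0⟩).smul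
      (continuous_logArgLin hm σ).continuousOn
  · rw [norm_smul, norm_inv]
    have := hle t ht
    have h2 := norm_logArgLin_le (n := n) (m := m) σ ht
    gcongr

/-- The branches are chosen separately for each x. By uniqueness, near x₀ the branch is the one at
x₀ plus the principal logarithm of a quotient, and only this logarithm has to be differentiated
under the integral. -/
theorem hasFDerivAt_logIntegral (hm : ∀ k, 0 < m k ∧ m k < n) (hμ : 0 < μ)
    (hμn : ∀ k, μ < (n : ℝ) - m k) {σ : ℝ} (hσ : σ = -1 ∨ σ = 1)
    {x₀ : Fin p → ℂ} (hx₀ : x₀ ∈ principalDomain n m) :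
    HasFDerivAt (logIntegral n m μ σ) (∫ t in (0 : ℝ)..1, (rootKernel n μ t : ℂ) •
      ((logArg n m σ x₀ t)⁻¹ • logArgLin n m σ t)) x₀ := by
  have hs := notMem_singularSet hx₀ hσ
  obtain ⟨δ, hδ, hb⟩ := exists_ball_isBoundedLog hm hs
  obtain ⟨δ', hδ', ε, hε, hb'⟩ := exists_ball_logArg hm hs
  have hL₀ := isBoundedLog_branchLog hm hσ hx₀
  have hint {x : Fin p → ℂ} (hx : x ∈ Metric.ball x₀ δ') :
      IntervalIntegrable (fun t => (rootKernel n μ t : ℂ) •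
        log (logArg n m σ x t / logArg n m σ x₀ t)) volume 0 1 :=
    intervalIntegrable_rootKernel_smul hm hμ hμn (C := 1)
      (continuousOn_log_logArg_div hm hs fun t ht => (hb' x hx t ht).2.1)
      fun t ht => by simpa using (hb' x hx t ht).2.2
  have hF : HasFDerivAt (fun x => ∫ t in (0 : ℝ)..1, (rootKernel n μ t : ℂ) •
      log (logArg n m σ x t / logArg n m σ x₀ t)) (∫ t in (0 : ℝ)..1, (rootKernel n μ t : ℂ) •
      ((logArg n m σ x₀ t)⁻¹ • logArgLin n m σ t)) x₀ := by
    have hae {P : ℝ → Prop} (h : ∀ t ∈ Set.Icc (0 : ℝ) 1, P t) :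
        ∀ᵐ t : ℝ, t ∈ Set.uIoc 0 1 → P t := by
      rw [Set.uIoc_of_le zero_le_one]
      exact Eventually.of_forall fun t ht => h t (Set.Ioc_subset_Icc_self ht)
    refine intervalIntegral.hasFDerivAt_integral_of_dominated_of_fderiv_le
      (F' := fun x t => (rootKernel n μ t : ℂ) • ((logArg n m σ x t)⁻¹ • logArgLin n m σ t))
      (bound := fun t => ε⁻¹ * (rootKernel n μ t * weightSum n m t))
      (Metric.ball_mem_nhds x₀ hδ') ?_ (hint (Metric.mem_ball_self hδ')) ?_ ?_ ?_ ?_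
    · filter_upwards [Metric.ball_mem_nhds x₀ hδ'] with x hx
      exact (hint hx).def'.aestronglyMeasurable
    · exact (intervalIntegrable_logIntegral_deriv hm hμ hμn hs).def'.aestronglyMeasurable
    · refine hae fun t ht x hx => ?_
      rw [norm_smul, norm_real, Real.norm_of_nonneg (rootKernel_nonneg ht), norm_smul, norm_inv]
      have h1 := (hb' x hx t ht).1
      have h2 := norm_logArgLin_le (n := n) (m := m) σ ht
      have h3 := rootKernel_nonneg (n := n) (μ := μ) ht
      calc _ ≤ rootKernel n μ t * (ε⁻¹ * weightSum n m t) := by gcongr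
        _ = _ := by ring
    · exact (intervalIntegrable_rootKernel_mul_weightSum hm hμ hμn).const_mul _
    · refine hae fun t ht x hx => HasFDerivAt.fun_const_smul ?_ _
      have hne₀ : logArg n m σ x₀ t ≠ 0 := fun h0 => hs ⟨t, ht, h0⟩
      have hne : logArg n m σ x t ≠ 0 := norm_pos_iff.1 (hε.trans_le (hb' x hx t ht).1)
      have h1 : HasFDerivAt (fun x => logArg n m σ x t / logArg n m σ x₀ t)
          ((logArg n m σ x₀ t)⁻¹ • logArgLin n m σ t) x := by
        have : (fun x => logArg n m σ x t / logArg n m σ x₀ t)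
            = fun x => (logArg n m σ x₀ t)⁻¹ • (1 + logArgLin n m σ t x) := by
          funext x; rw [logArg_eq σ x t, smul_eq_mul]; ring
        rw [this]
        exact ((logArgLin n m σ t).hasFDerivAt.const_add 1).fun_const_smul
          (logArg n m σ x₀ t)⁻¹
      have h2 := h1.clog (mem_slitPlane_of_norm_sub_one_le (hb' x hx t ht).2.1)
      have e : (logArg n m σ x t / logArg n m σ x₀ t)⁻¹ * (logArg n m σ x₀ t)⁻¹
          = (logArg n m σ x t)⁻¹ := by field_simp
      rwa [smul_smul, e] at h2
  refine (hF.const_add (logIntegral n m μ σ x₀)).congr_of_eventuallyEq ?_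
  filter_upwards [Metric.ball_mem_nhds x₀ hδ, Metric.ball_mem_nhds x₀ hδ',
    (isOpen_principalDomain hm).mem_nhds hx₀] with x h1 h2 h3
  rw [logIntegral, logIntegral, ← intervalIntegral.integral_add
    (intervalIntegrable_branchLog hm hμ hμn hσ hx₀) (hint h2)]
  refine intervalIntegral.integral_congr fun t ht => ?_
  rw [Set.uIcc_of_le zero_le_one] at ht
  have := (isBoundedLog_branchLog hm hσ h3).1.eqOn ((hb x h1 _).1 hL₀).1 ht
  simp only [this, smul_add]

end

/-! ### The exponential polynomial and its residue in the strip -/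

/-- The exponential sum `∑ₖ vₖ e^{nₖ w}`. -/
noncomputable def expSum {p : ℕ} (m : Fin p → ℕ) (v : Fin p → ℂ) (w : ℂ) : ℂ :=
  ∑ k, v k * exp (m k * w)

/-- The polynomial `1 - ζ^n - ∑ₖ xₖ ζ^{nₖ}` in the variable `ζ = e^w`. -/
noncomputable def charFn {p : ℕ} (n : ℕ) (m : Fin p → ℕ) (x : Fin p → ℂ) (w : ℂ) : ℂ :=
  1 - exp (n * w) - expSum m x w

section
variable {p n : ℕ} {m : Fin p → ℕ} {μ : ℝ}

theorem differentiable_expSum (v : Fin p → ℂ) : Differentiable ℂ (expSum m v) := by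
  unfold expSum; fun_prop

theorem differentiable_charFn (x : Fin p → ℂ) : Differentiable ℂ (charFn n m x) := by
  unfold charFn
  have := differentiable_expSum (m := m) x
  fun_prop

theorem norm_expSum_le (v : Fin p → ℂ) (w : ℂ) :
    ‖expSum m v w‖ ≤ ∑ k, ‖v k‖ * Real.exp (m k * w.re) := by
  refine (norm_sum_le _ _).trans (Finset.sum_le_sum fun k _ => ?_)
  rw [norm_mul, norm_exp]
  simp

theorem tendsto_exp_neg_mul {c : ℝ} (hc : 0 < c) :
    Tendsto (fun r : ℝ => Real.exp (-(c * r))) atTop (𝓝 0) :=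
  Real.tendsto_exp_neg_atTop_nhds_zero.comp (tendsto_id.const_mul_atTop hc)

/-- Decay of `e^{μw} expSum m v w / charFn n m x w` at both ends of a horizontal strip. -/
theorem exists_bound_charFn (hn : 0 < n) (hm : ∀ k, 0 < m k ∧ m k < n) (hμ : 0 < μ)
    (hμn : ∀ k, μ < (n : ℝ) - m k) (x v : Fin p → ℂ) :
    ∃ g : ℝ → ℝ, Tendsto g atTop (𝓝 0) ∧ ∀ᶠ r : ℝ in atTop, ∀ y : ℝ,
      ‖exp (μ * (r + y * I)) * expSum m v (r + y * I) / charFn n m x (r + y * I)‖ ≤ g r ∧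
      ‖exp (μ * (-r + y * I)) * expSum m v (-r + y * I) / charFn n m x (-r + y * I)‖ ≤ g r := by
  have hn' : (0 : ℝ) < n := by exact_mod_cast hn
  have hm1 (k : Fin p) : (0 : ℝ) < m k := by exact_mod_cast (hm k).1
  have hm2 (k : Fin p) : (0 : ℝ) < (n : ℝ) - m k := hμ.trans (hμn k)
  have lim (b : Fin p → ℝ) (v : Fin p → ℂ) (hb : ∀ k, 0 < b k) :
      Tendsto (fun r : ℝ => ∑ k, ‖v k‖ * Real.exp (-(b k * r))) atTop (𝓝 0) := by
    have := tendsto_finsetSum Finset.univ fun k _ =>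
      (tendsto_exp_neg_mul (hb k)).const_mul (‖v k‖)
    simpa using this
  have lim1 (b : Fin p → ℝ) (hb : ∀ k, 0 < b k) :
      ∀ᶠ r : ℝ in atTop, Real.exp (-(n * r)) + ∑ k, ‖x k‖ * Real.exp (-(b k * r)) ≤ 1 / 2 := by
    have := (tendsto_exp_neg_mul hn').add (lim b x hb)
    rw [add_zero] at this
    exact this.eventually_le_const (by norm_num)
  -- The first sum is for the right end, where |`charFn`| ≥ e^{nr}/2, the second for the left end,
  -- where |`charFn`| ≥ 1/2.
  refine ⟨fun r => 2 * ((∑ k, ‖v k‖ * Real.exp (-((n - m k - μ) * r)))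
    + ∑ k, ‖v k‖ * Real.exp (-((μ + m k) * r))), ?_, ?_⟩
  · have := ((lim (fun k => n - m k - μ) v fun k => by linarith [hμn k]).add
      (lim (fun k => μ + m k) v fun k => by linarith [hm1 k])).const_mul 2
    simpa using this
  filter_upwards [lim1 _ hm1, lim1 _ hm2] with r h1 h2 y
  have nonneg (b : Fin p → ℝ) : 0 ≤ ∑ k, ‖v k‖ * Real.exp (-(b k * r)) :=
    Finset.sum_nonneg fun k _ => by positivity
  have hre (r : ℝ) : ((r : ℂ) + y * I).re = r := by simp
  have hexp (c r : ℝ) : ‖exp (c * (r + y * I))‖ = Real.exp (c * r) := by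
    rw [norm_exp]; simp
  constructor
  · have hP : Real.exp (n * r) / 2 ≤ ‖charFn n m x (r + y * I)‖ := by
      have e1 : ‖charFn n m x (r + y * I) + exp (n * (r + y * I))‖
          ≤ 1 + ∑ k, ‖x k‖ * Real.exp (m k * r) := by
        have : charFn n m x (r + y * I) + exp (n * (r + y * I)) = 1 - expSum m x (r + y * I) := by
          rw [charFn]; ring
        rw [this]
        refine (norm_sub_le _ _).trans ?_
        have := norm_expSum_le (m := m) x (r + y * I)
        rw [hre] at this
        simpa using this
      have e2 : 1 + ∑ k, ‖x k‖ * Real.exp (m k * r) ≤ Real.exp (n * r) / 2 := by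
        have := mul_le_mul_of_nonneg_left h2 (Real.exp_pos (n * r)).le
        rw [mul_add, ← Real.exp_add, Finset.mul_sum] at this
        have e3 : ∀ k ∈ Finset.univ, Real.exp (n * r) * (‖x k‖ * Real.exp (-((n - m k) * r)))
            = ‖x k‖ * Real.exp (m k * r) := fun k _ => by
          rw [mul_left_comm, ← Real.exp_add]; ring_nf
        rw [Finset.sum_congr rfl e3] at this
        simp only [add_neg_cancel, Real.exp_zero] at this
        linarith
      have e4 := norm_sub_le (charFn n m x (r + y * I) + exp (n * (r + y * I)))
        (charFn n m x (r + y * I))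
      have e5 := hexp n r
      rw [add_sub_cancel_left] at e4
      push_cast at e5
      linarith
    have hA := norm_expSum_le (m := m) v (r + y * I)
    rw [hre] at hA
    rw [norm_div, norm_mul, hexp]
    calc _ ≤ Real.exp (μ * r) * (∑ k, ‖v k‖ * Real.exp (m k * r)) / (Real.exp (n * r) / 2) := by
          gcongr
      _ = 2 * ∑ k, ‖v k‖ * Real.exp (-((n - m k - μ) * r)) := by
          rw [Finset.mul_sum, Finset.sum_div, Finset.mul_sum]
          refine Finset.sum_congr rfl fun k _ => ?_
          have : Real.exp (-((n - m k - μ) * r))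
              = Real.exp (μ * r) * Real.exp (m k * r) / Real.exp (n * r) := by
            rw [← Real.exp_add, ← Real.exp_sub]; ring_nf
          rw [this]
          field_simp
      _ ≤ _ := by
          have := nonneg fun k => μ + m k
          linarith
  · have hre' : (-(r : ℂ) + y * I).re = -r := by simp
    have hexp' (c : ℝ) : ‖exp (c * (-r + y * I))‖ = Real.exp (-(c * r)) := by
      rw [norm_exp]; simp
    have hP : 1 / 2 ≤ ‖charFn n m x (-r + y * I)‖ := by
      have e1 : ‖1 - charFn n m x (-r + y * I)‖ ≤ 1 / 2 := by
        have : 1 - charFn n m x (-r + y * I)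
            = exp (n * (-r + y * I)) + expSum m x (-r + y * I) := by
          rw [charFn]; ring
        rw [this]
        refine (norm_add_le _ _).trans (le_trans (add_le_add ?_ ?_) h1)
        · have := hexp' n
          push_cast at this
          exact this.le
        · have := norm_expSum_le (m := m) x (-r + y * I)
          rw [hre'] at this
          simpa using this
      have e2 := norm_sub_norm_le (1 : ℂ) (1 - charFn n m x (-r + y * I))
      rw [sub_sub_cancel, norm_one] at e2
      linarith
    have hA := norm_expSum_le (m := m) v (-r + y * I)
    rw [hre'] at hA
    rw [norm_div, norm_mul, hexp']
    calc _ ≤ Real.exp (-(μ * r)) * (∑ k, ‖v k‖ * Real.exp (m k * -r)) / (1 / 2) := by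
          gcongr
      _ = 2 * ∑ k, ‖v k‖ * Real.exp (-((μ + m k) * r)) := by
          rw [Finset.mul_sum, Finset.sum_div, Finset.mul_sum]
          refine Finset.sum_congr rfl fun k _ => ?_
          have : Real.exp (-((μ + m k) * r)) = Real.exp (-(μ * r)) * Real.exp (m k * -r) := by
            rw [← Real.exp_add]; ring_nf
          rw [this]
          ring
      _ ≤ _ := by
          have := nonneg fun k => n - m k - μ
          linarith

/-- The residue formula for `e^{μw} expSum m v w / charFn n m x w` on the strip
`|Im w| ≤ π / n`. -/
theorem integral_strip_charFn (hn : 0 < n) (hm : ∀ k, 0 < m k ∧ m k < n) (hμ : 0 < μ)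
    (hμn : ∀ k, μ < (n : ℝ) - m k) {x v : Fin p → ℂ} {w₀ : ℂ} {a : ℝ} (h₀ : charFn n m x w₀ = 0)
    (him : |w₀.im| < a)
    (huniq : ∀ w : ℂ, |w.im| ≤ a → charFn n m x w = 0 → w = w₀)
    (hd : deriv (charFn n m x) w₀ ≠ 0) {E : ℂ → ℂ}
    (hE : E = fun w => exp (μ * w) * expSum m v w / charFn n m x w)
    (hbot : Integrable fun u : ℝ => E (u + (-a : ℝ) * I))
    (htop : Integrable fun u : ℝ => E (u + a * I)) :
    (∫ u : ℝ, E (u + (-a : ℝ) * I)) - (∫ u : ℝ, E (u + a * I)) =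
      2 * Real.pi * I * (exp (μ * w₀) * expSum m v w₀ / deriv (charFn n m x) w₀) := by
  set P := charFn n m x with hP
  have hPd : Differentiable ℂ P := differentiable_charFn x
  have hQd : Differentiable ℂ (dslope P w₀) := by
    rw [← differentiableOn_univ]
    exact (differentiableOn_dslope univ_mem).2 hPd.differentiableOn
  -- Dividing P by w - w₀ isolates the pole. The quotient has no zero in the strip, since w₀ is the
  -- only zero of P there and is simple.
  let M : ℂ → ℂ := fun w => exp (μ * w) * expSum m v w / dslope P w₀ w
  let s : Set ℂ := {w | dslope P w₀ w ≠ 0}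
  have hs : IsOpen s := isOpen_ne.preimage hQd.continuous
  have hM : DifferentiableOn ℂ M s := by
    refine DifferentiableOn.div ?_ hQd.differentiableOn fun w hw => hw
    have := differentiable_expSum (m := m) v
    exact Differentiable.differentiableOn (by fun_prop)
  have hPQ {w : ℂ} (hw : w ≠ w₀) : dslope P w₀ w = P w / (w - w₀) := by
    rw [dslope_of_ne _ hw, slope_def_field, h₀, sub_zero]
  have hsub : {w : ℂ | |w.im| ≤ a} ⊆ s := by
    intro w hw
    by_cases h : w = w₀
    · simpa [s, h] using hd
    · change dslope P w₀ w ≠ 0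
      rw [hPQ h]
      exact div_ne_zero (fun h' => h (huniq w hw h')) (sub_ne_zero.2 h)
  have hEM {w : ℂ} (hw : w ≠ w₀) : E w = M w / (w - w₀) := by
    have := sub_ne_zero.2 hw
    simp only [hE, M, hPQ hw]
    field_simp
  obtain ⟨g, hg0, hg⟩ := exists_bound_charFn hn hm hμ hμn x v
  have neI (u y : ℝ) (h : y ≠ w₀.im) : (u + y * I : ℂ) ≠ w₀ := fun h' => h (by rw [← h']; simp)
  have ha := abs_lt.1 him
  have hb' : ∀ u : ℝ, E (u + (-a : ℝ) * I) =
      M (u + (-a : ℝ) * I) / ((u + (-a : ℝ) * I : ℂ) - w₀) := fun u => hEM (neI _ _ ha.1.ne)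
  have ht' : ∀ u : ℝ, E (u + a * I) = M (u + a * I) / ((u + a * I : ℂ) - w₀) :=
    fun u => hEM (neI _ _ ha.2.ne')
  simp only [hb', ht'] at hbot htop ⊢
  rw [integral_strip_div_sub hs hM hsub him (g := g) ?_ hg0 hbot htop]
  · simp [M]
  · filter_upwards [hg, eventually_gt_atTop |w₀.re|] with r hr hr' y _
    have h2 := abs_lt.1 hr'
    have n1 : (r + y * I : ℂ) ≠ w₀ := fun h' => h2.2.ne (by rw [← h']; simp)
    have n2 : (-r + y * I : ℂ) ≠ w₀ := fun h' => h2.1.ne (by rw [← h']; simp)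
    rw [← hEM n1, ← hEM n2]
    simpa only [hE] using hr y

end

/-! ### The substitution t = e^{nu}/(1+e^{nu}) -/

theorem Real.sigmoid_eq_exp_mul (X : ℝ) : Real.sigmoid X = Real.exp X * (1 - Real.sigmoid X) := by
  rw [← Real.sigmoid_neg, ← Real.sigmoid_mul_rexp_neg, mul_left_comm, ← Real.exp_add]
  simp

theorem Real.sigmoid_rpow_mul_one_sub_rpow (X a b : ℝ) :
    Real.sigmoid X ^ a * (1 - Real.sigmoid X) ^ b
      = Real.exp (a * X) * (1 - Real.sigmoid X) ^ (a + b) := by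
  have h : 0 < 1 - Real.sigmoid X := by linarith [Real.sigmoid_lt_one X]
  nth_rewrite 1 [Real.sigmoid_eq_exp_mul X]
  rw [Real.mul_rpow (Real.exp_pos _).le h.le, ← Real.exp_mul, Real.rpow_add h, mul_comm X a,
    mul_assoc]

section
variable {p n : ℕ} {m : Fin p → ℕ} {μ : ℝ}

theorem exp_sign_mul_pi {σ : ℝ} (hσ : σ = -1 ∨ σ = 1) : exp (σ * Real.pi * I) = -1 := by
  rcases hσ with rfl | rfl
  · simp [exp_neg]
  · simp

/-- Since e^{σπi} = -1, the phase e^{σn'_kπi/n} is -e^{-σn_kπi/n}, that of -e^{n_k w} on Im w =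
-σπ/n. The weight exponents add up to 1, leaving one factor 1 - t. -/
theorem logArgLin_sigmoid (hn : 0 < n) {σ : ℝ} (hσ : σ = -1 ∨ σ = 1)
    (v : Fin p → ℂ) (u : ℝ) :
    logArgLin n m σ (Real.sigmoid (n * u)) v
      = -((1 - Real.sigmoid (n * u) : ℝ) : ℂ) * expSum m v (u + (-σ * (Real.pi / n) : ℝ) * I) := by
  have hn' : (n : ℝ) ≠ 0 := by exact_mod_cast hn.ne'
  have hnc : (n : ℂ) ≠ 0 := by exact_mod_cast hn.ne'
  simp only [logArgLin, sum_apply, smul_apply,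
    ContinuousLinearMap.proj_apply, smul_eq_mul, expSum, Finset.mul_sum]
  refine Finset.sum_congr rfl fun k _ => ?_
  have e1 : (m k : ℝ) / n + ((n : ℝ) - m k) / n = 1 := by field_simp; ring
  have e2 : (m k : ℝ) / n * (n * u) = m k * u := by field_simp
  rw [Real.sigmoid_rpow_mul_one_sub_rpow, e1, e2, Real.rpow_one]
  have e3 : exp (m k * ((u : ℂ) + (-σ * (Real.pi / n) : ℝ) * I))
      = exp (m k * u) * exp (-(σ * (m k / n) * Real.pi * I)) := by
    rw [← exp_add]; congr 1; push_cast; ring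
  have e4 : exp (σ * ((((n : ℝ) - m k) / n : ℝ) : ℂ) * Real.pi * I)
      = -exp (-(σ * (m k / n) * Real.pi * I)) := by
    rw [← neg_one_mul, ← exp_sign_mul_pi hσ, ← exp_add]
    congr 1; push_cast; field_simp; ring
  rw [e3, e4]
  push_cast
  ring

/-- The constant 1 is (1-t)(1+e^{nu}), and e^{nu} = -e^{nw} on the line. Thus σ = -1 is the upper
edge of the strip and σ = 1 the lower. -/
theorem logArg_sigmoid (hn : 0 < n) {σ : ℝ} (hσ : σ = -1 ∨ σ = 1) (x : Fin p → ℂ) (u : ℝ) :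
    logArg n m σ x (Real.sigmoid (n * u))
      = ((1 - Real.sigmoid (n * u) : ℝ) : ℂ) *
        charFn n m x (u + (-σ * (Real.pi / n) : ℝ) * I) := by
  have hnc : (n : ℂ) ≠ 0 := by exact_mod_cast hn.ne'
  rw [logArg_eq, logArgLin_sigmoid hn hσ, charFn]
  have e1 : exp (n * ((u : ℂ) + (-σ * (Real.pi / n) : ℝ) * I)) = -Real.exp (n * u) := by
    have : (n : ℂ) * ((u : ℂ) + (-σ * (Real.pi / n) : ℝ) * I) = n * u - σ * Real.pi * I := by
      push_cast; field_simp; ring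
    rw [this, exp_sub, exp_sign_mul_pi hσ]
    push_cast; ring
  rw [e1]
  have e2 : ((1 - Real.sigmoid (n * u) : ℝ) : ℂ) * (1 + Real.exp (n * u)) = 1 := by
    rw [mul_add, mul_one, mul_comm _ (Real.exp _ : ℂ), ← ofReal_mul, ← Real.sigmoid_eq_exp_mul,
      ← ofReal_add, sub_add_cancel, ofReal_one]
  linear_combination -e2

/-- Multiplied by t(1-t), the kernel is (t/(1-t))^{μ/n}, and t/(1-t) = e^{nu}. -/
theorem rootKernel_sigmoid (hn : 0 < n) (μ u : ℝ) :
    n * (Real.sigmoid (n * u) * (1 - Real.sigmoid (n * u))) * rootKernel n μ (Real.sigmoid (n * u))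
      = n * Real.exp (μ * u) := by
  have hn' : (n : ℝ) ≠ 0 := by exact_mod_cast hn.ne'
  have h : 0 < 1 - Real.sigmoid (n * u) := by linarith [Real.sigmoid_lt_one (n * u)]
  have e1 : (μ / n - 1) + (-(μ / n) - 1) = -(2 : ℕ) := by push_cast; ring
  have e2 : (μ / n - 1) * (n * u) = μ * u - n * u := by field_simp
  rw [rootKernel, Real.sigmoid_rpow_mul_one_sub_rpow, e1, e2, Real.exp_sub, Real.rpow_neg h.le,
    Real.rpow_natCast]
  have h3 := Real.sigmoid_eq_exp_mul (n * u)
  have h4 := Real.exp_pos (n * u)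
  set q := 1 - Real.sigmoid (n * u)
  rw [h3]
  field_simp

theorem hasDerivAt_sigmoid_mul (c u : ℝ) : HasDerivAt (fun u => Real.sigmoid (c * u))
    (c * (Real.sigmoid (c * u) * (1 - Real.sigmoid (c * u)))) u := by
  have h1 : HasDerivAt (fun u : ℝ => c * u) c u := by simpa using (hasDerivAt_id u).const_mul c
  have := (Real.hasDerivAt_sigmoid (c * u)).comp u h1
  rw [mul_comm] at this
  exact this

theorem image_sigmoid_mul {c : ℝ} (hc : c ≠ 0) :
    (fun u => Real.sigmoid (c * u)) '' Set.univ = Set.Ioo 0 1 := by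
  rw [Set.image_univ, ← Real.range_sigmoid]
  ext t
  constructor
  · rintro ⟨u, rfl⟩; exact ⟨_, rfl⟩
  · rintro ⟨u, rfl⟩; exact ⟨u / c, by simp [mul_div_cancel₀ _ hc]⟩

/-- The substitution `t = e^{nu} / (1 + e^{nu})`. -/
theorem integral_rootKernel_eq {E : Type*} [NormedAddCommGroup E] [NormedSpace ℂ E] (hn : 0 < n)
    {g : ℝ → E} (hg : IntervalIntegrable (fun t => (rootKernel n μ t : ℂ) • g t) volume 0 1) :
    Integrable (fun u : ℝ => exp (μ * u) • g (Real.sigmoid (n * u))) ∧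
    ∫ t in (0 : ℝ)..1, (rootKernel n μ t : ℂ) • g t
      = (n : ℂ) • ∫ u : ℝ, exp (μ * u) • g (Real.sigmoid (n * u)) := by
  have hn' : (n : ℝ) ≠ 0 := by exact_mod_cast hn.ne'
  have hnc : (n : ℂ) ≠ 0 := by exact_mod_cast hn.ne'
  have hinj : Set.InjOn (fun u => Real.sigmoid (n * u)) Set.univ := fun a _ b _ h =>
    mul_left_cancel₀ hn' (Real.sigmoid_injective h)
  have hder : ∀ u ∈ Set.univ, HasDerivWithinAt (fun u => Real.sigmoid (n * u))
      (n * (Real.sigmoid (n * u) * (1 - Real.sigmoid (n * u)))) Set.univ u :=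
    fun u _ => (hasDerivAt_sigmoid_mul n u).hasDerivWithinAt
  have hcongr (u : ℝ) : |n * (Real.sigmoid (n * u) * (1 - Real.sigmoid (n * u)))| •
      ((rootKernel n μ (Real.sigmoid (n * u)) : ℂ) • g (Real.sigmoid (n * u)))
      = (n : ℂ) • (exp (μ * u) • g (Real.sigmoid (n * u))) := by
    have h1 : 0 < Real.sigmoid (n * u) := Real.sigmoid_pos _
    have h2 : 0 < 1 - Real.sigmoid (n * u) := by linarith [Real.sigmoid_lt_one (n * u)]
    rw [abs_of_nonneg (by positivity), ← Complex.coe_smul, smul_smul, smul_smul, ← ofReal_mul,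
      rootKernel_sigmoid hn]
    push_cast
    rfl
  constructor
  · have h1 := (intervalIntegrable_iff_integrableOn_Ioo_of_le zero_le_one).1 hg
    rw [← image_sigmoid_mul hn', integrableOn_image_iff_integrableOn_abs_deriv_smul
      MeasurableSet.univ hder hinj, integrableOn_univ] at h1
    simp only [hcongr] at h1
    have := h1.smul (n : ℂ)⁻¹
    simpa [Pi.smul_def, smul_smul, hnc] using this
  · rw [intervalIntegral.integral_of_le zero_le_one, integral_Ioc_eq_integral_Ioo,
      ← image_sigmoid_mul hn', integral_image_eq_integral_abs_deriv_smul MeasurableSet.univ hder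
      hinj, setIntegral_univ]
    simp only [hcongr]
    rw [integral_smul]

/-! ### The right-hand side and its derivative -/

/-- The candidate `1 + μ/(2πi n) ∫₀¹ …` for `z(x)^μ`. -/
noncomputable def rootPower {p : ℕ} (n : ℕ) (m : Fin p → ℕ) (μ : ℝ) (x : Fin p → ℂ) : ℂ :=
  1 + (μ : ℂ) / (2 * Real.pi * I * n) *
    (exp (((μ / n : ℝ) : ℂ) * Real.pi * I) * logIntegral n m μ (-1) x
      - exp (-(((μ / n : ℝ) : ℂ) * Real.pi * I)) * logIntegral n m μ 1 x)

theorem logIntegral_zero (hm : ∀ k, 0 < m k ∧ m k < n) {σ : ℝ} (hσ : σ = -1 ∨ σ = 1) :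
    logIntegral n m μ σ 0 = 0 := by
  have h0 : IsLogBranch (logArg n m σ 0) 0 :=
    ⟨continuousOn_const, rfl, fun t _ => by simp [logArg_zero_left]⟩
  rw [logIntegral, intervalIntegral.integral_congr (g := fun _ => (0 : ℂ))]
  · simp
  · intro t ht
    rw [Set.uIcc_of_le zero_le_one] at ht
    simp [(isBoundedLog_branchLog hm hσ zero_mem_principalDomain).1.eqOn h0 ht]

theorem rootPower_zero (hm : ∀ k, 0 < m k ∧ m k < n) : rootPower n m μ 0 = 1 := by
  simp [rootPower, logIntegral_zero hm]

theorem differentiableAt_rootPower (hm : ∀ k, 0 < m k ∧ m k < n) (hμ : 0 < μ)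
    (hμn : ∀ k, μ < (n : ℝ) - m k) {x : Fin p → ℂ} (hx : x ∈ principalDomain n m) :
    DifferentiableAt ℂ (rootPower n m μ) x := by
  have h1 := (hasFDerivAt_logIntegral hm hμ hμn (Or.inl rfl) hx).differentiableAt
  have h2 := (hasFDerivAt_logIntegral hm hμ hμn (Or.inr rfl) hx).differentiableAt
  unfold rootPower
  fun_prop

/-- The directional derivative of `logIntegral` as an integral along a horizontal line. -/
theorem fderiv_logIntegral_eq (hn : 0 < n) (hm : ∀ k, 0 < m k ∧ m k < n) (hμ : 0 < μ)
    (hμn : ∀ k, μ < (n : ℝ) - m k) {σ : ℝ} (hσ : σ = -1 ∨ σ = 1)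
    {x : Fin p → ℂ} (hx : x ∈ principalDomain n m) (v : Fin p → ℂ) {E : ℂ → ℂ}
    (hE : E = fun w => exp (μ * w) * expSum m v w / charFn n m x w) :
    Integrable (fun u : ℝ => E (u + (-σ * (Real.pi / n) : ℝ) * I)) ∧
    exp (-σ * (((μ / n : ℝ) : ℂ) * Real.pi * I)) * fderiv ℂ (logIntegral n m μ σ) x v
      = -n * ∫ u : ℝ, E (u + (-σ * (Real.pi / n) : ℝ) * I) := by
  have hint := intervalIntegrable_logIntegral_deriv hm hμ hμn (notMem_singularSet hx hσ)
  obtain ⟨h1, h2⟩ := integral_rootKernel_eq hn hint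
  -- The factor 1 - t cancels in the logarithmic derivative, and the prefactor completes e^{μu} to
  -- e^{μw} on the line.
  have hcongr (u : ℝ) : E (u + (-σ * (Real.pi / n) : ℝ) * I)
      = -exp (-σ * (((μ / n : ℝ) : ℂ) * Real.pi * I)) *
        (exp (μ * u) • ((logArg n m σ x (Real.sigmoid (n * u)))⁻¹ •
          logArgLin n m σ (Real.sigmoid (n * u)))) v := by
    have hq : ((1 - Real.sigmoid (n * u) : ℝ) : ℂ) ≠ 0 := by
      rw [ofReal_ne_zero]; linarith [Real.sigmoid_lt_one (n * u)]
    simp only [smul_apply, smul_eq_mul]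
    rw [logArgLin_sigmoid hn hσ, logArg_sigmoid hn hσ, hE]
    have e : exp (μ * ((u : ℂ) + (-σ * (Real.pi / n) : ℝ) * I))
        = exp (-σ * (((μ / n : ℝ) : ℂ) * Real.pi * I)) * exp (μ * u) := by
      rw [← exp_add]; congr 1; push_cast; ring
    simp only [e]
    generalize ((1 - Real.sigmoid (n * u) : ℝ) : ℂ) = q at hq
    rw [mul_inv, div_eq_mul_inv]
    field_simp
  have h1v : Integrable fun u : ℝ => (exp (μ * u) • ((logArg n m σ x (Real.sigmoid (n * u)))⁻¹ •
      logArgLin n m σ (Real.sigmoid (n * u)))) v := h1.apply_continuousLinearMap v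
  simp only [hcongr]
  refine ⟨h1v.const_mul _, ?_⟩
  rw [(hasFDerivAt_logIntegral hm hμ hμn hσ hx).fderiv, h2, smul_apply,
    ContinuousLinearMap.integral_apply h1, integral_const_mul, smul_eq_mul]
  ring

theorem fderiv_rootPower_eq (hn : 0 < n) (hm : ∀ k, 0 < m k ∧ m k < n) (hμ : 0 < μ)
    (hμn : ∀ k, μ < (n : ℝ) - m k) {x : Fin p → ℂ} (hx : x ∈ principalDomain n m)
    (v : Fin p → ℂ) {w₀ : ℂ} (h₀ : charFn n m x w₀ = 0) (him : |w₀.im| < Real.pi / n)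
    (huniq : ∀ w : ℂ, |w.im| ≤ Real.pi / n → charFn n m x w = 0 → w = w₀)
    (hd : deriv (charFn n m x) w₀ ≠ 0) :
    fderiv ℂ (rootPower n m μ) x v
      = μ * exp (μ * w₀) * expSum m v w₀ / deriv (charFn n m x) w₀ := by
  have hd1 := (hasFDerivAt_logIntegral hm hμ hμn (Or.inl rfl) hx).differentiableAt.hasFDerivAt
  have hd2 := (hasFDerivAt_logIntegral hm hμ hμn (Or.inr rfl) hx).differentiableAt.hasFDerivAt
  obtain ⟨i1, e1⟩ := fderiv_logIntegral_eq hn hm hμ hμn (Or.inl rfl) hx v rfl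
  obtain ⟨i2, e2⟩ := fderiv_logIntegral_eq hn hm hμ hμn (Or.inr rfl) hx v rfl
  have hD := (((hd1.const_mul (exp (((μ / n : ℝ) : ℂ) * Real.pi * I))).sub
    (hd2.const_mul (exp (-(((μ / n : ℝ) : ℂ) * Real.pi * I))))).const_mul
      ((μ : ℂ) / (2 * Real.pi * I * n))).const_add 1
  have hfd : fderiv ℂ (rootPower n m μ) x = _ := HasFDerivAt.fderiv hD
  rw [hfd]
  simp only [neg_neg, one_mul, neg_mul, ofReal_neg, ofReal_one] at i1 i2 e1 e2
  have hres := integral_strip_charFn hn hm hμ hμn h₀ him huniq hd (v := v) rfl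
    (by simpa using i2) (by simpa using i1)
  have hnc : (n : ℂ) ≠ 0 := by exact_mod_cast hn.ne'
  have hpi : (Real.pi : ℂ) ≠ 0 := by exact_mod_cast Real.pi_ne_zero
  simp only [smul_apply, sub_apply, smul_eq_mul]
  rw [e1, e2]
  simp only [ofReal_neg, neg_mul] at hres ⊢
  rw [sub_eq_iff_eq_add] at hres
  rw [hres]
  field_simp
  ring

end

/-! ### Complex lines through the origin, parametrised by the zero -/

/-- The scalar `s` for which `w` is a zero of `charFn n m (s • x)`. -/
noncomputable def zeroScale {p : ℕ} (n : ℕ) (m : Fin p → ℕ) (x : Fin p → ℂ) (w : ℂ) : ℂ :=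
  (1 - exp (n * w)) / expSum m x w

section
variable {p n : ℕ} {m : Fin p → ℕ} {μ : ℝ}

theorem expSum_smul (s : ℂ) (x : Fin p → ℂ) (w : ℂ) :
    expSum m (s • x) w = s * expSum m x w := by
  simp [expSum, Finset.mul_sum, mul_assoc]

theorem expSum_zero_right (x : Fin p → ℂ) : expSum m x 0 = ∑ k, x k := by simp [expSum]

theorem zeroScale_zero (x : Fin p → ℂ) : zeroScale n m x 0 = 0 := by simp [zeroScale]

theorem charFn_zeroScale {x : Fin p → ℂ} {w : ℂ} (h : expSum m x w ≠ 0) :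
    charFn n m (zeroScale n m x w • x) w = 0 := by
  rw [charFn, expSum_smul, zeroScale]
  field_simp
  ring

theorem eq_zeroScale {x : Fin p → ℂ} {s w : ℂ} (h : expSum m x w ≠ 0)
    (h0 : charFn n m (s • x) w = 0) : s = zeroScale n m x w := by
  rw [charFn, expSum_smul] at h0
  rw [zeroScale, eq_div_iff h]
  linear_combination -h0

theorem differentiableAt_zeroScale {x : Fin p → ℂ} {w : ℂ} (h : expSum m x w ≠ 0) :
    DifferentiableAt ℂ (zeroScale n m x) w := by
  have := differentiable_expSum (m := m) x w
  exact DifferentiableAt.div (by fun_prop) this h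

theorem hasDerivAt_one_sub_exp (n : ℕ) (w : ℂ) :
    HasDerivAt (fun w : ℂ => 1 - exp (n * w)) (-(n * exp (n * w))) w := by
  have h1 : HasDerivAt (fun w : ℂ => (n : ℂ) * w) n w := by
    simpa using (hasDerivAt_id w).const_mul (n : ℂ)
  have := h1.cexp.const_sub 1
  rwa [mul_comm] at this

/-- With Q = 1 - e^{nw} and Q = sA identically, the derivative Q' - sA' at frozen s is s'A. So the
zero is simple when s' ≠ 0, and s'A cancels in the residue formula. -/
theorem deriv_charFn_zeroScale {x : Fin p → ℂ} {w : ℂ} (h : expSum m x w ≠ 0) :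
    deriv (charFn n m (zeroScale n m x w • x)) w
      = deriv (zeroScale n m x) w * expSum m x w := by
  have hA := (differentiable_expSum (m := m) x w).hasDerivAt
  have hQ := hasDerivAt_one_sub_exp n w
  have h1 : HasDerivAt (charFn n m (zeroScale n m x w • x))
      (-(n * exp (n * w)) - zeroScale n m x w * deriv (expSum m x) w) w := by
    have := hQ.sub (hA.const_mul (zeroScale n m x w))
    refine this.congr_of_eventuallyEq (Eventually.of_forall fun w' => ?_)
    simp [charFn, expSum_smul]
  have h2 : HasDerivAt (zeroScale n m x) _ w := hQ.div hA h
  rw [h1.deriv, h2.deriv, zeroScale]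
  field_simp

theorem deriv_zeroScale_zero_ne (hn : 0 < n) {x : Fin p → ℂ} (hx : ∑ k, x k ≠ 0) :
    deriv (zeroScale n m x) 0 ≠ 0 := by
  have h : expSum m x 0 ≠ 0 := by rwa [expSum_zero_right]
  have hA := (differentiable_expSum (m := m) x 0).hasDerivAt
  have h2 : HasDerivAt (zeroScale n m x) _ 0 := (hasDerivAt_one_sub_exp n 0).div hA h
  rw [h2.deriv]
  have hnc : (n : ℂ) ≠ 0 := by exact_mod_cast hn.ne'
  simpa [hnc] using h

theorem norm_expSum_le_mul (hm : ∀ k, 0 < m k ∧ m k < n) (x : Fin p → ℂ) (w : ℂ) :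
    ‖expSum m x w‖ ≤ (∑ k, ‖x k‖) * (1 + ‖exp (n * w)‖) := by
  refine (norm_expSum_le x w).trans ?_
  rw [Finset.sum_mul]
  refine Finset.sum_le_sum fun k _ => mul_le_mul_of_nonneg_left ?_ (norm_nonneg _)
  have e : ‖exp (n * w)‖ = Real.exp (n * w.re) := by rw [norm_exp]; simp
  rw [e]
  have hmn : (m k : ℝ) ≤ n := by exact_mod_cast (hm k).2.le
  rcases le_total w.re 0 with h | h
  · have : Real.exp (m k * w.re) ≤ 1 :=
      Real.exp_le_one_iff.2 (mul_nonpos_of_nonneg_of_nonpos (Nat.cast_nonneg _) h)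
    linarith [Real.exp_pos (n * w.re)]
  · have : Real.exp (m k * w.re) ≤ Real.exp (n * w.re) :=
      Real.exp_le_exp.2 (mul_le_mul_of_nonneg_right hmn h)
    linarith

/-- In the closed strip `|Im w| ≤ π / n`, the only point where `e^{nw}` is close to `1` is near
`0`. -/
theorem exists_norm_lt_of_exp_near_one (hn : 0 < n) {ρ : ℝ} (hρ : 0 < ρ) :
    ∃ c > 0, ∀ w : ℂ, |w.im| ≤ Real.pi / n → ‖1 - exp (n * w)‖ < c → ‖w‖ < ρ := by
  have hn' : (0 : ℝ) < n := by exact_mod_cast hn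
  have hlog : ContinuousAt log 1 := continuousAt_clog one_mem_slitPlane
  obtain ⟨c, hc, h⟩ := Metric.continuousAt_iff.1 hlog (n * ρ) (by positivity)
  -- The bound 1 excludes n Im w = -π, where e^{nw} is negative and `log` does not invert `exp`.
  refine ⟨min c 1, by positivity, fun w hw hlt => ?_⟩
  have h1 := h (x := exp (n * w)) (by
    rw [dist_comm, dist_eq_norm]; exact hlt.trans_le (min_le_left _ _))
  have him : ((n : ℂ) * w).im = n * w.im := by simp
  have hre : ((n : ℂ) * w).re = n * w.re := by simp
  have habs : |n * w.im| ≤ Real.pi := by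
    rw [abs_mul, abs_of_pos hn', mul_comm]
    exact (le_div_iff₀ hn').1 hw
  have hne : n * w.im ≠ -Real.pi := by
    intro h'
    have h2 : (exp (n * w)).re = -Real.exp (n * w.re) := by
      rw [exp_re, him, hre, h', Real.cos_neg, Real.cos_pi]; ring
    have h3 := (abs_re_le_norm (1 - exp (n * w))).trans_lt (hlt.trans_le (min_le_right _ _))
    rw [sub_re, one_re, h2] at h3
    have := (abs_lt.1 h3).2
    linarith [Real.exp_pos (n * w.re)]
  have habs' := abs_le.1 habs
  rw [log_one, dist_zero_right, log_exp (by
      rw [him]; exact lt_of_le_of_ne habs'.1 hne.symm) (by rw [him]; exact habs'.2), norm_mul,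
    norm_natCast] at h1
  exact lt_of_mul_lt_mul_left h1 (Nat.cast_nonneg n)

/-- For `w` near `0`, `w` is the only zero of `charFn n m (zeroScale n m x w • x)` in the closed
strip. -/
theorem eventually_unique_zero (hn : 0 < n) (hm : ∀ k, 0 < m k ∧ m k < n) {x : Fin p → ℂ}
    (hx : ∑ k, x k ≠ 0) :
    ∀ᶠ w in 𝓝 (0 : ℂ), expSum m x w ≠ 0 ∧ deriv (zeroScale n m x) w ≠ 0 ∧
      (w ≠ 0 → zeroScale n m x w ≠ 0) ∧
      ∀ w' : ℂ, |w'.im| ≤ Real.pi / n → charFn n m (zeroScale n m x w • x) w' = 0 → w' = w := by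
  have hA0 : expSum m x 0 ≠ 0 := by rwa [expSum_zero_right]
  have hA : ∀ᶠ w in 𝓝 (0 : ℂ), expSum m x w ≠ 0 :=
    (differentiable_expSum (m := m) x).continuous.continuousAt.eventually_ne hA0
  have han : AnalyticAt ℂ (zeroScale n m x) 0 :=
    analyticAt_iff_eventually_differentiableAt.2 (hA.mono fun w hw => differentiableAt_zeroScale hw)
  have hd0 := deriv_zeroScale_zero_ne (m := m) hn hx
  have hd : ∀ᶠ w in 𝓝 (0 : ℂ), deriv (zeroScale n m x) w ≠ 0 :=
    han.deriv.continuousAt.eventually_ne hd0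
  -- The inverse function theorem makes w ↦ s(w) injective near 0.
  have hinv := (han.hasStrictDerivAt.hasStrictFDerivAt_equiv hd0).eventually_left_inverse
  obtain ⟨ρ, hρ, hball⟩ := Metric.eventually_nhds_iff_ball.1 (hA.and hinv)
  have hinj : ∀ w ∈ Metric.ball (0 : ℂ) ρ, ∀ w' ∈ Metric.ball (0 : ℂ) ρ,
      zeroScale n m x w = zeroScale n m x w' → w = w' := by
    intro w hw w' hw' h
    rw [← (hball w hw).2, h, (hball w' hw').2]
  obtain ⟨c, hc, hnear⟩ := exists_norm_lt_of_exp_near_one hn hρ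
  -- Where |1 - e^{nw'}| ≥ c, the sum is at most (∑ |x_k|)(2/c + 1)|1 - e^{nw'}|, so a small s
  -- forbids a zero w' there; the remaining w' are near 0, where injectivity decides.
  have hs : Tendsto (fun w => ‖zeroScale n m x w‖ * ((∑ k, ‖x k‖) * (2 / c + 1))) (𝓝 0) (𝓝 0) := by
    have h1 : Tendsto (zeroScale n m x) (𝓝 0) (𝓝 0) := by
      have := han.continuousAt.tendsto
      rwa [zeroScale_zero] at this
    simpa using h1.norm.mul_const ((∑ k, ‖x k‖) * (2 / c + 1))
  filter_upwards [hA, hd, Metric.ball_mem_nhds 0 hρ, hs.eventually_lt_const one_pos]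
    with w h1 h2 h3 h4
  refine ⟨h1, h2, fun h h0 => h (hinj w h3 0 (Metric.mem_ball_self hρ)
    (by rw [h0, zeroScale_zero])), fun w' hw' h0 => ?_⟩
  have hlt : ‖1 - exp (n * w')‖ < c := by
    by_contra! hge
    have e1 : 1 - exp (n * w') = zeroScale n m x w * expSum m x w' := by
      rw [charFn, expSum_smul] at h0
      linear_combination h0
    have e2 : 1 + ‖exp (n * w')‖ ≤ (2 / c + 1) * ‖1 - exp (n * w')‖ := by
      have i1 := norm_sub_norm_le (exp (n * w')) 1
      rw [norm_one, norm_sub_rev] at i1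
      have i2 : 2 ≤ 2 / c * ‖1 - exp (n * w')‖ := by
        rw [div_mul_eq_mul_div, le_div_iff₀ hc]; linarith
      linarith
    have e3 := norm_expSum_le_mul hm x w'
    have hpos : 0 < ‖1 - exp (n * w')‖ := hc.trans_le hge
    have hB : 0 ≤ ∑ k, ‖x k‖ := Finset.sum_nonneg fun _ _ => norm_nonneg _
    have e4 : ‖1 - exp (n * w')‖ ≤
        ‖zeroScale n m x w‖ * ((∑ k, ‖x k‖) * (2 / c + 1)) * ‖1 - exp (n * w')‖ := by
      calc ‖1 - exp (n * w')‖ = ‖zeroScale n m x w‖ * ‖expSum m x w'‖ := by rw [e1, norm_mul]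
        _ ≤ ‖zeroScale n m x w‖ * ((∑ k, ‖x k‖) * ((2 / c + 1) * ‖1 - exp (n * w')‖)) := by
          gcongr
          exact e3.trans (mul_le_mul_of_nonneg_left e2 hB)
        _ = _ := by ring
    have := mul_lt_mul_of_pos_right h4 hpos
    linarith
  have hw'b : w' ∈ Metric.ball (0 : ℂ) ρ := by
    rw [Metric.mem_ball, dist_zero_right]; exact hnear w' hw' hlt
  exact (hinj w h3 w' hw'b (eq_zeroScale (hball w' hw'b).1 h0)).symm

theorem eventually_zeroScale_mem (hm : ∀ k, 0 < m k ∧ m k < n) {x : Fin p → ℂ}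
    (hx : ∑ k, x k ≠ 0) : ∀ᶠ w in 𝓝 (0 : ℂ), zeroScale n m x w • x ∈ principalDomain n m := by
  have hc : ContinuousAt (zeroScale n m x) 0 :=
    (differentiableAt_zeroScale (by rwa [expSum_zero_right])).continuousAt
  have h1 : Tendsto (fun w => zeroScale n m x w • x) (𝓝 0) (𝓝 0) := by
    simpa [zeroScale_zero] using (hc.fun_smul (continuousAt_const (y := x))).tendsto
  exact h1.eventually ((isOpen_principalDomain hm).mem_nhds zero_mem_principalDomain)

/-- Both sides are 1 at w = 0 and have derivative μ e^{μw}, by the residue formula in direction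
s'(w)x. -/
theorem eventually_rootPower_eq (hn : 0 < n) (hm : ∀ k, 0 < m k ∧ m k < n) (hμ : 0 < μ)
    (hμn : ∀ k, μ < (n : ℝ) - m k) {x : Fin p → ℂ} (hx : ∑ k, x k ≠ 0) :
    ∀ᶠ w in 𝓝 (0 : ℂ), rootPower n m μ (zeroScale n m x w • x) = exp (μ * w) := by
  have hn' : (0 : ℝ) < n := by exact_mod_cast hn
  have him : ∀ᶠ w in 𝓝 (0 : ℂ), |w.im| < Real.pi / n := by
    have : ContinuousAt (fun w : ℂ => |w.im|) 0 := by fun_prop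
    exact this.eventually_lt_const (by simpa using div_pos Real.pi_pos hn')
  obtain ⟨ρ, hρ, hball⟩ := Metric.eventually_nhds_iff_ball.1
    ((eventually_unique_zero hn hm hx).and ((eventually_zeroScale_mem hm hx).and him))
  have hE (w : ℂ) : HasDerivAt (fun w : ℂ => exp (μ * w)) (μ * exp (μ * w)) w := by
    have h1 : HasDerivAt (fun w : ℂ => (μ : ℂ) * w) μ w := by
      simpa using (hasDerivAt_id w).const_mul (μ : ℂ)
    simpa [mul_comm] using h1.cexp
  have hD : ∀ w ∈ Metric.ball (0 : ℂ) ρ, HasDerivAt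
      (fun w => rootPower n m μ (zeroScale n m x w • x)) (μ * exp (μ * w)) w := by
    intro w hw
    obtain ⟨⟨hA, hd, -, hu⟩, hU, hi⟩ := hball w hw
    have h1 := (differentiableAt_rootPower hm hμ hμn hU).hasFDerivAt
    have h2 : HasDerivAt (fun w => zeroScale n m x w • x) (deriv (zeroScale n m x) w • x) w :=
      (differentiableAt_zeroScale hA).hasDerivAt.smul_const x
    have h3 := h1.comp_hasDerivAt w h2
    have hder := deriv_charFn_zeroScale (n := n) hA
    rw [fderiv_rootPower_eq hn hm hμ hμn hU _ (charFn_zeroScale hA) hi hu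
      (by rw [hder]; exact mul_ne_zero hd hA), hder, expSum_smul,
      mul_div_cancel_right₀ _ (mul_ne_zero hd hA)] at h3
    exact h3
  have := Metric.isOpen_ball.eqOn_of_deriv_eq (convex_ball (0 : ℂ) ρ).isPreconnected
    (fun w hw => (hD w hw).differentiableAt.differentiableWithinAt)
    (fun w _ => (hE w).differentiableAt.differentiableWithinAt)
    (fun w hw => by rw [(hD w hw).deriv, (hE w).deriv]) (Metric.mem_ball_self hρ)
    (by simp [zeroScale_zero, rootPower_zero hm])
  filter_upwards [Metric.ball_mem_nhds 0 hρ] with w hw using this hw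

/-- A holomorphic function on the principal domain vanishes if it does so along the curves
`w ↦ zeroScale n m x w • x`. -/
theorem eqOn_zero_of_eventually_zeroScale (hn : 0 < n) (hm : ∀ k, 0 < m k ∧ m k < n)
    {F : (Fin p → ℂ) → ℂ} (hF : DifferentiableOn ℂ F (principalDomain n m)) (hF0 : F 0 = 0)
    (h : ∀ x : Fin p → ℂ, ∑ k, x k ≠ 0 → ∀ᶠ w in 𝓝 (0 : ℂ), F (zeroScale n m x w • x) = 0) :
    Set.EqOn F 0 (principalDomain n m) := by
  rcases p.eq_zero_or_pos with rfl | hp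
  · intro x _
    rw [Subsingleton.elim x 0]
    exact hF0
  obtain ⟨r, hr, hball⟩ := Metric.isOpen_iff.1 (isOpen_principalDomain hm) 0
    zero_mem_principalDomain
  have key : ∀ x ∈ Metric.ball (0 : Fin p → ℂ) r, ∑ k, x k ≠ 0 → F x = 0 := by
    intro x hxr hx
    let V : Set ℂ := {s | ‖s‖ * ‖x‖ < r}
    have hmem {s : ℂ} (hs : s ∈ V) : s • x ∈ principalDomain n m :=
      hball (by rw [Metric.mem_ball, dist_zero_right, norm_smul]; exact hs)
    have hVo : IsOpen V := isOpen_lt (by fun_prop) continuous_const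
    have hVc : Convex ℝ V := by
      have := ((convexOn_univ_norm (E := ℂ)).smul (norm_nonneg x)).convex_lt r
      have e : V = {s : ℂ | s ∈ Set.univ ∧ ‖x‖ • ‖s‖ < r} := by
        ext s
        simp [V, mul_comm]
      rw [e]
      exact this
    have hd : DifferentiableOn ℂ (fun s : ℂ => F (s • x)) V :=
      hF.comp (Differentiable.differentiableOn (by fun_prop)) fun s hs => hmem hs
    have h0 : (0 : ℂ) ∈ V := by simpa [V] using hr
    have h1 : (1 : ℂ) ∈ V := by simpa [V] using hxr
    -- Since s(w) → 0 with s(w) ≠ 0 for w ≠ 0, the zeros of s ↦ F(s • x) accumulate at 0.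
    have hfreq : ∃ᶠ s in 𝓝[≠] (0 : ℂ), F (s • x) = 0 := by
      have hc : Tendsto (zeroScale n m x) (𝓝[≠] 0) (𝓝[≠] 0) := by
        refine tendsto_nhdsWithin_iff.2 ⟨?_, ?_⟩
        · have : ContinuousAt (zeroScale n m x) 0 :=
            (differentiableAt_zeroScale (by rwa [expSum_zero_right])).continuousAt
          have := this.tendsto
          rw [zeroScale_zero] at this
          exact this.mono_left nhdsWithin_le_nhds
        · rw [eventually_nhdsWithin_iff]
          exact (eventually_unique_zero hn hm hx).mono fun w hw hne => hw.2.2.1 hne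
      exact hc.frequently
        (Eventually.frequently (eventually_nhdsWithin_of_eventually_nhds (h x hx)))
    have := (hd.analyticOnNhd hVo).eqOn_zero_of_preconnected_of_frequently_eq_zero
      hVc.isPreconnected h0 hfreq h1
    simpa using this
  -- A point of the ball with nonzero coordinate sum: F vanishes on a whole neighbourhood of it.
  let x₁ : Fin p → ℂ := Pi.single ⟨0, hp⟩ ((r / 2 : ℝ) : ℂ)
  have hx₁ : x₁ ∈ Metric.ball (0 : Fin p → ℂ) r := by
    rw [Metric.mem_ball, dist_zero_right, Pi.norm_single, norm_real,
      Real.norm_of_nonneg (by linarith)]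
    linarith
  have hsum : ∑ k, x₁ k ≠ 0 := by
    simp only [x₁, Finset.sum_pi_single', Finset.mem_univ, if_true]
    exact_mod_cast (half_pos hr).ne'
  refine hF.eqOn_zero_of_preconnected (isOpen_principalDomain hm) isPreconnected_principalDomain
    (hball hx₁) ?_
  have hcs : Continuous fun x : Fin p → ℂ => ∑ k, x k := by fun_prop
  filter_upwards [Metric.isOpen_ball.mem_nhds hx₁, hcs.continuousAt.eventually_ne hsum]
    with x h1 h2 using key x h1 h2

end

/-! ### The principal root and its powers -/

section
variable {p n : ℕ} {m : Fin p → ℕ} {μ : ℝ}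

/-- The principal root, as the square of `rootPower n m (1/2)`. -/
noncomputable def principalRoot {p : ℕ} (n : ℕ) (m : Fin p → ℕ) (x : Fin p → ℂ) : ℂ :=
  rootPower n m (1 / 2) x ^ 2

/-- The exponent 1/2 is always admissible because n'_k ≥ 1, whereas 1 itself fails when some n'_k =
1. -/
theorem half_lt_sub (hm : ∀ k, 0 < m k ∧ m k < n) (k : Fin p) : (1 / 2 : ℝ) < (n : ℝ) - m k := by
  have : ((m k + 1 : ℕ) : ℝ) ≤ n := by exact_mod_cast (hm k).2
  push_cast at this
  linarith

theorem differentiableOn_principalRoot (hm : ∀ k, 0 < m k ∧ m k < n) :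
    DifferentiableOn ℂ (principalRoot n m) (principalDomain n m) := fun _ hx =>
  ((differentiableAt_rootPower hm one_half_pos (half_lt_sub hm) hx).fun_pow
    2).differentiableWithinAt

theorem eventually_principalRoot_eq (hn : 0 < n) (hm : ∀ k, 0 < m k ∧ m k < n) {x : Fin p → ℂ}
    (hx : ∑ k, x k ≠ 0) :
    ∀ᶠ w in 𝓝 (0 : ℂ), principalRoot n m (zeroScale n m x w • x) = exp w := by
  filter_upwards [eventually_rootPower_eq hn hm one_half_pos (half_lt_sub hm) hx] with w hw
  rw [principalRoot, hw, ← exp_nat_mul]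
  congr 1
  push_cast
  ring

theorem isPrincipalRoot_principalRoot (hn : 0 < n) (hm : ∀ k, 0 < m k ∧ m k < n) :
    IsPrincipalRoot n m (principalRoot n m) := by
  have hd := differentiableOn_principalRoot hm
  have h0 : principalRoot n m 0 = 1 := by simp [principalRoot, rootPower_zero hm]
  refine ⟨hd, h0, eqOn_zero_of_eventually_zeroScale hn hm ?_ (by simp [h0]) fun x hx => ?_⟩
  · fun_prop
  · filter_upwards [eventually_principalRoot_eq hn hm hx, eventually_unique_zero hn hm hx]
      with w h1 h2
    have h3 := charFn_zeroScale (n := n) h2.1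
    simp only [charFn, expSum, exp_nat_mul] at h3
    rw [h1]
    linear_combination -h3

theorem IsPrincipalRoot.ne_zero {z : (Fin p → ℂ) → ℂ} (hn : 0 < n) (hm : ∀ k, 0 < m k ∧ m k < n)
    (hz : IsPrincipalRoot n m z) {x : Fin p → ℂ} (hx : x ∈ principalDomain n m) : z x ≠ 0 := by
  intro h
  have := hz.root x hx
  rw [h, zero_pow hn.ne', Finset.sum_eq_zero fun k _ => by rw [zero_pow (hm k).1.ne', mul_zero]]
    at this
  simp at this

/-- Otherwise log z(x) would be a zero of `charFn` on the edge of the strip, hence a zero of a loop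
at the corresponding t. -/
theorem IsPrincipalRoot.abs_arg_ne {z : (Fin p → ℂ) → ℂ} (hn : 0 < n)
    (hm : ∀ k, 0 < m k ∧ m k < n) (hz : IsPrincipalRoot n m z) {x : Fin p → ℂ}
    (hx : x ∈ principalDomain n m) : |arg (z x)| ≠ Real.pi / n := by
  have key {σ : ℝ} (hσ : σ = -1 ∨ σ = 1) : arg (z x) ≠ -σ * (Real.pi / n) := by
    intro h
    refine notMem_singularSet hx hσ ⟨Real.sigmoid (n * Real.log ‖z x‖),
      ⟨Real.sigmoid_nonneg _, Real.sigmoid_le_one _⟩, ?_⟩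
    have hlog : (Real.log ‖z x‖ : ℂ) + (-σ * (Real.pi / n) : ℝ) * I = log (z x) := by
      rw [← h]; rfl
    rw [logArg_sigmoid hn hσ, hlog]
    refine mul_eq_zero_of_right _ ?_
    have := hz.root x hx
    simp only [charFn, expSum, exp_nat_mul, exp_log (hz.ne_zero hn hm hx)]
    linear_combination -this
  intro h
  rcases abs_choice (arg (z x)) with h' | h' <;> rw [h'] at h
  · exact key (Or.inl rfl) (by rw [h]; ring)
  · exact key (Or.inr rfl) (by linarith)

/-- The principal root stays in the sector `|arg z| < π / n`. -/
theorem IsPrincipalRoot.abs_arg_lt {z : (Fin p → ℂ) → ℂ} (hn : 0 < n)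
    (hm : ∀ k, 0 < m k ∧ m k < n) (hz : IsPrincipalRoot n m z) {x : Fin p → ℂ}
    (hx : x ∈ principalDomain n m) : |arg (z x)| < Real.pi / n := by
  -- The angle with 1 equals |arg| but, unlike arg, is continuous across the negative axis, so the
  -- intermediate value theorem applies.
  have hang {y : Fin p → ℂ} (hy : y ∈ principalDomain n m) :
      InnerProductGeometry.angle 1 (z y) = |arg (z y)| := angle_one_left (hz.ne_zero hn hm hy)
  have hc : ContinuousOn (fun y => InnerProductGeometry.angle 1 (z y)) (principalDomain n m) := by
    intro y hy
    exact (InnerProductGeometry.continuousAt_angle (x := ((1 : ℂ), z y)) one_ne_zero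
      (hz.ne_zero hn hm hy)).comp_continuousWithinAt
      (f := fun y => ((1 : ℂ), z y))
      (continuousWithinAt_const.prodMk (hz.holomorphic.continuousOn y hy))
  by_contra! hge
  have hn' : (0 : ℝ) < n := by exact_mod_cast hn
  obtain ⟨y, hy, h⟩ := isPreconnected_principalDomain.intermediate_value
    zero_mem_principalDomain hx hc (show Real.pi / n ∈ Set.Icc _ _ from
      ⟨by rw [hang zero_mem_principalDomain, hz.at_zero]; simp; positivity, by rwa [hang hx]⟩)
  exact hz.abs_arg_ne hn hm hy ((hang hy).symm.trans h)

theorem IsPrincipalRoot.mem_slitPlane {z : (Fin p → ℂ) → ℂ} (hn : 0 < n)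
    (hm : ∀ k, 0 < m k ∧ m k < n) (hz : IsPrincipalRoot n m z) {x : Fin p → ℂ}
    (hx : x ∈ principalDomain n m) : z x ∈ slitPlane := by
  refine mem_slitPlane_iff_arg.2 ⟨fun h => ?_, hz.ne_zero hn hm hx⟩
  have h1 := hz.abs_arg_lt hn hm hx
  rw [h, abs_of_pos Real.pi_pos] at h1
  exact h1.not_ge (div_le_self Real.pi_pos.le (by exact_mod_cast hn))

/-- Both sides are holomorphic on U and equal e^{μw} at s(w)x for small w, where |Im w| < π makes w
the principal logarithm. -/
theorem principalRoot_cpow_eq (hn : 0 < n) (hm : ∀ k, 0 < m k ∧ m k < n) (hμ : 0 < μ)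
    (hμn : ∀ k, μ < (n : ℝ) - m k) {x : Fin p → ℂ} (hx : x ∈ principalDomain n m) :
    principalRoot n m x ^ (μ : ℂ) = rootPower n m μ x := by
  have hz := isPrincipalRoot_principalRoot hn hm
  have h0 := hz.at_zero
  refine sub_eq_zero.1 (eqOn_zero_of_eventually_zeroScale hn hm
    (F := fun x => principalRoot n m x ^ (μ : ℂ) - rootPower n m μ x) ?_
    (by simp [h0, rootPower_zero hm]) (fun x hx => ?_) hx)
  · intro y hy
    have h1 := hz.holomorphic y hy
    have h2 := (differentiableAt_rootPower hm hμ hμn hy).differentiableWithinAt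
      (s := principalDomain n m)
    exact (h1.cpow (differentiableWithinAt_const _) (hz.mem_slitPlane hn hm hy)).sub h2
  · have him : ∀ᶠ w in 𝓝 (0 : ℂ), |w.im| < Real.pi := by
      have : ContinuousAt (fun w : ℂ => |w.im|) 0 := by fun_prop
      exact this.eventually_lt_const (by simpa using Real.pi_pos)
    filter_upwards [eventually_principalRoot_eq hn hm hx, eventually_rootPower_eq hn hm hμ hμn hx,
      him] with w h1 h2 h3
    have h3 := abs_lt.1 h3
    rw [h1, h2, cpow_def_of_ne_zero (exp_ne_zero _), log_exp h3.1 h3.2.le, mul_comm, sub_self]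

/-- Two principal roots agree on the principal domain. -/
theorem IsPrincipalRoot.eqOn {z w : (Fin p → ℂ) → ℂ} (hn : 0 < n) (hm : ∀ k, 0 < m k ∧ m k < n)
    (hz : IsPrincipalRoot n m z) (hw : IsPrincipalRoot n m w) :
    Set.EqOn w z (principalDomain n m) := by
  have hU := (isOpen_principalDomain hm).mem_nhds zero_mem_principalDomain
  -- The difference of the two root equations is (w - z)D, and D(0) = n because the coefficients x_k
  -- vanish at 0.
  let D : (Fin p → ℂ) → ℂ := fun x => (∑ i ∈ Finset.range n, w x ^ i * z x ^ (n - 1 - i)) +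
    ∑ k, x k * ∑ i ∈ Finset.range (m k), w x ^ i * z x ^ (m k - 1 - i)
  have hD : ContinuousAt D 0 := by
    have h1 := hz.holomorphic.differentiableAt hU
    have h2 := hw.holomorphic.differentiableAt hU
    refine DifferentiableAt.continuousAt (𝕜 := ℂ) ?_
    simp only [D]
    fun_prop
  have hD0 : D 0 ≠ 0 := by
    simpa [D, hz.at_zero, hw.at_zero] using hn.ne'
  have hsub : Set.EqOn (fun x => w x - z x) 0 (principalDomain n m) := by
    refine (hw.holomorphic.sub hz.holomorphic).eqOn_zero_of_preconnected
      (isOpen_principalDomain hm) isPreconnected_principalDomain zero_mem_principalDomain ?_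
    filter_upwards [hU, hD.eventually_ne hD0] with x hx hne
    have e : (w x - z x) * D x = 0 := by
      have h1 := hz.root x hx
      have h2 := hw.root x hx
      simp only [D, mul_add, Finset.mul_sum (s := (Finset.univ : Finset (Fin p))),
        mul_left_comm (w x - z x)]
      simp only [mul_comm (w x - z x), Commute.geom_sum₂_mul (Commute.all (w x) (z x)), mul_sub,
        Finset.sum_sub_distrib]
      linear_combination h2 - h1
    exact (mul_eq_zero.1 e).resolve_right hne
  exact fun x hx => sub_eq_zero.1 (hsub hx)

/-- The integrand does not depend on the choice of the logarithms. -/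
theorem rootIntegrand_eq (hm : ∀ k, 0 < m k ∧ m k < n) {x : Fin p → ℂ}
    (hx : x ∈ principalDomain n m) {Lm Lp : ℝ → ℂ} (hLm : IsLogBranch (logArg n m (-1) x) Lm)
    (hLp : IsLogBranch (logArg n m 1 x) Lp) {t : ℝ} (ht : t ∈ Set.Icc (0 : ℝ) 1) :
    rootIntegrand n μ Lm Lp t
      = exp (((μ / n : ℝ) : ℂ) * Real.pi * I) *
          ((rootKernel n μ t : ℂ) • branchLog n m (-1) x t)
        - exp (-(((μ / n : ℝ) : ℂ) * Real.pi * I)) *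
          ((rootKernel n μ t : ℂ) • branchLog n m 1 x t) := by
  rw [(isBoundedLog_branchLog hm (Or.inl rfl) hx).1.eqOn hLm ht,
    (isBoundedLog_branchLog hm (Or.inr rfl) hx).1.eqOn hLp ht, rootIntegrand, ← rootKernel]
  simp only [smul_eq_mul]
  ring

end

theorem mainTheorem1 (p n : ℕ) (hn : 0 < n) (m : Fin p → ℕ) (hm : ∀ k, 0 < m k ∧ m k < n) :
    ∃ z : (Fin p → ℂ) → ℂ,
      IsPrincipalRoot n m z ∧
      (∀ w, IsPrincipalRoot n m w → Set.EqOn w z (principalDomain n m)) ∧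
      ∀ x ∈ principalDomain n m,
        (∃ Lm, IsLogBranch (logArg n m (-1) x) Lm) ∧
        (∃ Lp, IsLogBranch (logArg n m 1 x) Lp) ∧
        ∀ Lm Lp, IsLogBranch (logArg n m (-1) x) Lm → IsLogBranch (logArg n m 1 x) Lp →
          ∀ μ : ℝ, 0 < μ → (∀ k, μ < (n : ℝ) - m k) →
            IntervalIntegrable (rootIntegrand n μ Lm Lp) MeasureTheory.volume 0 1 ∧
            z x ^ (μ : ℂ) =
              1 + (μ : ℂ) / (2 * Real.pi * Complex.I * n) *
                ∫ t in (0 : ℝ)..1, rootIntegrand n μ Lm Lp t := by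
  have hz := isPrincipalRoot_principalRoot hn hm
  refine ⟨principalRoot n m, hz, fun w hw => hz.eqOn hn hm hw, fun x hx =>
    ⟨⟨_, (isBoundedLog_branchLog hm (Or.inl rfl) hx).1⟩,
      ⟨_, (isBoundedLog_branchLog hm (Or.inr rfl) hx).1⟩, fun Lm Lp hLm hLp μ hμ hμn => ?_⟩⟩
  have i1 := (intervalIntegrable_branchLog hm hμ hμn (Or.inl rfl) hx).const_mul
    (exp (((μ / n : ℝ) : ℂ) * Real.pi * I))
  have i2 := (intervalIntegrable_branchLog hm hμ hμn (Or.inr rfl) hx).const_mul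
    (exp (-(((μ / n : ℝ) : ℂ) * Real.pi * I)))
  constructor
  · refine (i1.sub i2).congr fun t ht => ?_
    rw [Set.uIoc_of_le zero_le_one] at ht
    exact (rootIntegrand_eq hm hx hLm hLp (Set.Ioc_subset_Icc_self ht)).symm
  · rw [principalRoot_cpow_eq hn hm hμ hμn hx, rootPower,
      intervalIntegral.integral_congr fun t ht => rootIntegrand_eq hm hx hLm hLp
        (by rwa [Set.uIcc_of_le zero_le_one] at ht),
      intervalIntegral.integral_sub i1 i2, intervalIntegral.integral_const_mul,
      intervalIntegral.integral_const_mul, logIntegral, logIntegral]
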